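/- For a convex body (nonempty compact convex set) $K\subset\mathbb R^n$ let $s(K)=\inf\{\rho>0:\exists c\in\mathbb R^n,\ -K\subset c+\rho K\}$ be its Minkowski asymmetry. Given a norm $\|\cdot\|$ on $\mathbb R^n$ with unit ball $B$, let $D(K)$, $R(K)$, $r(K)$ denote the diameter, circumradius and inradius of $K$ with respect to $\|\cdot\|$; a point $c$ with $K\subset c+R(K)B$ is a circumcentre of $K$. $K$ is complete if $D(K\cup\{x\})>D(K)$ for all $x\notin K$; a completion of $K$ is a complete body $K^*\supset K$ with $D(K^*)=D(K)$; $K$ has constant width if $h(K-K,u)/h(B,u)$ does not depend on $u\ne 0$, where $h$ is the support function. For a circumcentre $c$ of $K$ the pseudo completion is $K^+=\operatorname{conv}\bigl(K\cup(c+(D(K)-R(K))B)\bigr)$. "Symmetric" means centrally symmetric about some point; two sets are similar with respect to a norm if some map multiplying all distances of that norm by a fixed positive factor maps one onto the other. A class $\mathcal K$ of convex bodies has property (B) for $s$ if, for all $K,L\in\mathcal K$, $s(K+L)=\max\{s(K),s(L)\}$ implies that $K$ is symmetric, or $L$ is symmetric, or $K$ and $L$ are similar (in the Euclidean sense). Let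 $T\subset\mathbb R^n$ be an $n$-dimensional (Euclidean) regular simplex. (1) Let $\|\cdot\|$ be any norm on $\mathbb R^n$, $c$ a circumcentre of $T$ and $T^+$ the pseudo completion of $T$ with respect to $c$. Then $T$ has a completion contained in the circumball $c+R(T)B$. If $T^+$ is not complete, then for every completion $T^*$ of $T$ with $T^*\subset c+R(T)B$, the sets $T^+,T^*$ are convex bodies with $$R(T^++T^*)+r(T^++T^*)=R(T^+)+r(T^+)+R(T^*)+r(T^*)=D(T^+)+D(T^*)=D(T^++T^*),$$ $$s(T^++T^*)=\frac{R(T^++T^*)}{r(T^++T^*)}=s(T^+)=s(T^*),$$ while neither $T^+$ nor $T^*$ is symmetric, and $T^+$ and $T^*$ are not similar, neither with respect to $\|\cdot\|$ nor in the Euclidean sense. (2) For $n\ge 2$ the Euclidean space $\mathbb E^n$ is such a space: there $T^+$ is not complete, and every completion of $T$ is contained in the circumball of $T$. Hence for $n\ge2$ property (B) fails for $s$ on the class of all convex bodies in $\mathbb R^n$. (3) For $n\ge 2$ property (B) fails for $s$ even on the class of bodies of constant width in $\mathbb E^n$. More precisely, in $\mathbb E^n$ with $n\ge 2$, any completions $K,L$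 of $T$ are non-symmetric, have constant width and satisfy $s(K+L)=s(K)=s(L)$; and if $n\ge 3$, there are two completions $K,L$ of $T$ that are not similar. In $\mathbb E^2$ the unique completion of $T$ is the Reuleaux triangle $\bigcap_i (v_i+D(T)B)$, where the $v_i$ are the vertices of $T$; but there exist bodies $K,L$ of constant width, less asymmetric than the Reuleaux triangle ($s(K)=s(L)<s(T^*)$ with $T^*$ the completion of $T$), neither symmetric nor similar to each other, with $s(K+L)=s(K)=s(L)$. -/

import Mathlib

open scoped Pointwise

namespace PropB

/-- Euclidean `n`-space. -/
abbrev E (n : ℕ) : Type := EuclideanSpace ℝ (Fin n)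

/-- The Euclidean norm of `ℝⁿ`, regarded as one of the norms on `ℝⁿ`. -/
noncomputable abbrev euclid (n : ℕ) : Seminorm ℝ (E n) := normSeminorm ℝ (E n)

variable {n : ℕ}

/-- Convex bodies: nonempty compact convex sets. -/
def IsConvexBody (K : Set (E n)) : Prop :=
  Convex ℝ K ∧ IsCompact K ∧ K.Nonempty

/-- The Minkowski asymmetry
`s(K) = inf {ρ > 0 : ∃ c, -K ⊆ c + ρ K}`. -/
noncomputable def asymmetry (K : Set (E n)) : ℝ :=
  sInf {ρ : ℝ | 0 < ρ ∧ ∃ c : E n, -K ⊆ c +ᵥ ρ • K}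

/-- `K` is centrally symmetric about some point `p`. -/
def IsCentrallySymmetric (K : Set (E n)) : Prop :=
  ∃ p : E n, ∀ x ∈ K, (2 : ℝ) • p - x ∈ K

/-- `L` is the image of `K` under a similarity with respect to the norm `N`, that is, a map
which multiplies all `N`-distances by one fixed positive factor. -/
def AreSimilar (N : Seminorm ℝ (E n)) (K L : Set (E n)) : Prop :=
  ∃ (f : E n → E n) (ρ : ℝ), 0 < ρ ∧ (∀ x y, N (f x - f y) = ρ * N (x - y)) ∧ f '' K = L

/-- Property (B) for a functional `s` on a class `𝒦` of sets: equality in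
`s(K + L) ≤ max {s(K), s(L)}` forces `K` or `L` to be centrally symmetric, or `K` and `L` to be
similar (in the Euclidean sense). -/
def PropertyB (s : Set (E n) → ℝ) (𝒦 : Set (Set (E n))) : Prop :=
  ∀ K ∈ 𝒦, ∀ L ∈ 𝒦, s (K + L) = max (s K) (s L) →
    IsCentrallySymmetric K ∨ IsCentrallySymmetric L ∨ AreSimilar (euclid n) K L

/-! The radii of `K` in the space `ℝⁿ` with norm `N`; its unit ball is `N.closedBall 0 1`. -/

/-- The diameter `D(K)`. -/
noncomputable def diam (N : Seminorm ℝ (E n)) (K : Set (E n)) : ℝ :=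
  sSup (Set.image2 (fun x y => N (x - y)) K K)

/-- The circumradius `R(K)`. -/
noncomputable def circumradius (N : Seminorm ℝ (E n)) (K : Set (E n)) : ℝ :=
  sInf {ρ : ℝ | 0 < ρ ∧ ∃ c : E n, K ⊆ N.closedBall c ρ}

/-- The inradius `r(K)`. -/
noncomputable def inradius (N : Seminorm ℝ (E n)) (K : Set (E n)) : ℝ :=
  sSup {ρ : ℝ | 0 < ρ ∧ ∃ c : E n, N.closedBall c ρ ⊆ K}

/-- `c` is a circumcentre of `K`, i.e. `c + R(K) B` is a circumball of `K`. -/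
def IsCircumcenter (N : Seminorm ℝ (E n)) (K : Set (E n)) (c : E n) : Prop :=
  K ⊆ N.closedBall c (circumradius N K)

/-- The support function `h(K, u)`. -/
noncomputable def supportFn (K : Set (E n)) (u : E n) : ℝ :=
  sSup ((fun x => inner ℝ x u) '' K)

/-- The width `h(K - K, u) / h(B, u)` of `K` in direction `u`. -/
noncomputable def dirWidth (N : Seminorm ℝ (E n)) (K : Set (E n)) (u : E n) : ℝ :=
  supportFn (K - K) u / supportFn (N.closedBall 0 1) u

/-- The (minimal) width `w(K)`. -/
noncomputable def width (N : Seminorm ℝ (E n)) (K : Set (E n)) : ℝ :=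
  ⨅ u : {u : E n // u ≠ 0}, dirWidth N K u

/-- Bodies of constant width. -/
def IsConstantWidth (N : Seminorm ℝ (E n)) (K : Set (E n)) : Prop :=
  IsConvexBody K ∧ ∀ u : E n, u ≠ 0 → dirWidth N K u = width N K

/-- (Diametrically) complete bodies: adding any further point enlarges the diameter. -/
def IsCompleteBody (N : Seminorm ℝ (E n)) (K : Set (E n)) : Prop :=
  IsConvexBody K ∧ ∀ x ∉ K, diam N K < diam N (insert x K)

/-- `L` is a completion of `K`. -/
def IsCompletion (N : Seminorm ℝ (E n)) (K L : Set (E n)) : Prop :=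
  K ⊆ L ∧ IsCompleteBody N L ∧ diam N L = diam N K

/-- The pseudo completion `K⁺ = conv (K ∪ (c + (D(K) - R(K)) B))` of `K`
with respect to the circumcentre `c` of `K`. -/
noncomputable def pseudoCompletion (N : Seminorm ℝ (E n)) (K : Set (E n)) (c : E n) :
    Set (E n) :=
  convexHull ℝ (K ∪ N.closedBall c (diam N K - circumradius N K))

/-- The convex body spanned by a simplex. -/
def body (T : Affine.Simplex ℝ (E n) n) : Set (E n) :=
  convexHull ℝ (Set.range T.points)

end PropB

/-! ### Diameter-maximal sets, and sets squeezed between concentric balls -/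

namespace PropB
variable {n : ℕ}

/-! Everything about radii and asymmetry follows from one squeeze. Let `T` have circumradius `R`,
and let `X ⊇ T` have diameter at most `d` and lie between the concentric balls of radii `d - R` and
`R` (`IsTight`). The diameter bound then forces the circumradius to be `R`, the inradius `d - R` and
the asymmetry `R / (d - R)` (`IsTight.asymmetry_eq`). A Minkowski sum of two such sets is again
squeezed, with all data doubled (`IsTight.add`), so the asymmetry of the sum equals that of the
summands. The pseudo completion and every completion inside the circumball are squeezed with the
same data, and the former is contained in the latter.

It remains to exclude similarity. For `P ⊊ K` compact, a similarity of ratio at most one from `P`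
onto `K` has a noncontracting inverse `K → P`, impossible by recurrence (`eq_of_similarity_le_one`).
With respect to the given norm, equal diameters bound the ratio by one. An expanding Euclidean
similarity is affine; its linear part can be iterated against functionals dual to the circumradius,
which stay bounded although the iterates expand without limit (`not_image_eq_of_expanding`).

In Euclidean space the balls of radius `ℓ` about the vertices of a regular simplex of edge `ℓ` meet
inside its circumball (`norm_sub_centre_le`), so all completions are squeezed. The pseudo completion
has a segment in its boundary, while complete bodies are strictly convex.

For constant width, suppose that all inscribed bodies were similar. The similarities would be
isometries fixing the centre, so the rotation invariant quadratic `supportEnergy` would agree on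
`A`, `B` and `(A + B) / 2`; the parallelogram identity then gives `A = B`. Hence two admissible
extra points more than `d` apart already yield non-similar bodies
(`exists_isInscribed_not_areSimilar`). For `3 ≤ n` such points exist for the simplex itself; in the
plane they exist after shrinking the triangle while keeping the diameter bound. -/

/-- All distances between points of `K` are at most `d`. -/
def DiamLE (N : Seminorm ℝ (E n)) (K : Set (E n)) (d : ℝ) : Prop :=
  ∀ x ∈ K, ∀ y ∈ K, N (x - y) ≤ d

/-- `K` is a convex body maximal among the sets of diameter at most `d`. -/
def IsDiamMaximal (N : Seminorm ℝ (E n)) (d : ℝ) (K : Set (E n)) : Prop :=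
  IsConvexBody K ∧ DiamLE N K d ∧ ∀ x, (∀ y ∈ K, N (x - y) ≤ d) → x ∈ K

/-- `R` is at most the radius of every ball containing `T`. -/
def RadiusGE (N : Seminorm ℝ (E n)) (T : Set (E n)) (R : ℝ) : Prop :=
  ∀ (c : E n) (ρ : ℝ), T ⊆ N.closedBall c ρ → R ≤ ρ

/-- `X` is a convex set of diameter at most `d` containing `T` and lying between the concentric
balls of radii `d - R` and `R` about `c`. -/
structure IsTight (N : Seminorm ℝ (E n)) (T : Set (E n)) (c : E n) (d R : ℝ)
    (X : Set (E n)) : Prop where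
  convex : Convex ℝ X
  sub : T ⊆ X
  ball_sub : N.closedBall c (d - R) ⊆ X
  sub_ball : X ⊆ N.closedBall c R
  diamLE : DiamLE N X d

variable {N : Seminorm ℝ (E n)} {T X Y K P : Set (E n)} {c : E n} {d R : ℝ}

lemma seminorm_continuous (N : Seminorm ℝ (E n)) : Continuous N :=
  (ConvexOn.locallyLipschitz N.convexOn).continuous

lemma exists_seminorm_le (N : Seminorm ℝ (E n)) : ∃ C > 0, ∀ x, N x ≤ C * ‖x‖ := by
  obtain ⟨C, hC, h⟩ := Seminorm.bound_of_continuous_normedSpace N (seminorm_continuous N)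
  exact ⟨C, hC, h⟩

lemma exists_norm_le (hN : ∀ x, N x = 0 → x = 0) : ∃ C > 0, ∀ x, ‖x‖ ≤ C * N x := by
  rcases (Metric.sphere (0 : E n) 1).eq_empty_or_nonempty with h | h
  · refine ⟨1, one_pos, fun x => ?_⟩
    by_cases hx : x = 0
    · simp [hx]
    · exfalso
      have : (‖x‖⁻¹ • x) ∈ Metric.sphere (0 : E n) 1 := by
        simp [norm_smul, norm_ne_zero_iff.2 hx]
      simp [h] at this
  · obtain ⟨z, hz, hm⟩ := (isCompact_sphere (0 : E n) 1).exists_isMinOn h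
      (seminorm_continuous N).continuousOn
    have hz0 : 0 < N z := by
      refine lt_of_le_of_ne (apply_nonneg N z) fun h0 => ?_
      have := hN z h0.symm
      simp [this] at hz
    refine ⟨(N z)⁻¹, inv_pos.2 hz0, fun x => ?_⟩
    by_cases hx : x = 0
    · simp [hx]
    · have hx' : 0 < ‖x‖ := norm_pos_iff.2 hx
      have h1 : (‖x‖⁻¹ • x) ∈ Metric.sphere (0 : E n) 1 := by
        simp [norm_smul, norm_ne_zero_iff.2 hx]
      have h2 := hm h1
      simp only [Set.mem_ofPred_eq, map_smul_eq_mul, norm_inv, norm_norm] at h2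
      rw [inv_mul_eq_div, le_div_iff₀ hz0]
      rw [inv_mul_eq_div, le_div_iff₀ hx'] at h2
      linarith

lemma isCompact_seminorm_closedBall (hN : ∀ x, N x = 0 → x = 0) (c : E n) (r : ℝ) :
    IsCompact (N.closedBall c r) := by
  obtain ⟨C, hC, h⟩ := exists_norm_le hN
  refine Metric.isCompact_of_isClosed_isBounded ?_ ?_
  · have : N.closedBall c r = (fun y => N (y - c)) ⁻¹' Set.Iic r := by
      ext y; simp [Seminorm.mem_closedBall]
    rw [this]
    exact isClosed_Iic.preimage ((seminorm_continuous N).comp (continuous_id.sub continuous_const))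
  · refine (Metric.isBounded_closedBall (x := c) (r := C * r)).subset fun y hy => ?_
    rw [Seminorm.mem_closedBall] at hy
    rw [Metric.mem_closedBall, dist_eq_norm]
    exact (h _).trans (by gcongr)

lemma DiamLE.le_diam (h : DiamLE N K d) {x y : E n} (hx : x ∈ K) (hy : y ∈ K) :
    N (x - y) ≤ diam N K :=
  le_csSup ⟨d, by rintro _ ⟨a, ha, b, hb, rfl⟩; exact h a ha b hb⟩ ⟨x, hx, y, hy, rfl⟩

lemma DiamLE.diam_le (h : DiamLE N K d) (hne : K.Nonempty) : diam N K ≤ d := by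
  obtain ⟨x, hx⟩ := hne
  exact csSup_le ⟨_, x, hx, x, hx, rfl⟩ (by rintro _ ⟨a, ha, b, hb, rfl⟩; exact h a ha b hb)

lemma DiamLE.diam_eq (h : DiamLE N K d) (hX : X ⊆ K) (hne : X.Nonempty) (hd : d ≤ diam N X) :
    diam N K = d := by
  refine le_antisymm (h.diam_le (hne.mono hX)) (hd.trans ?_)
  exact DiamLE.diam_le (fun x hx y hy => h.le_diam (hX hx) (hX hy)) hne

lemma exists_diamLE (hK : IsCompact K) : ∃ d, DiamLE N K d := by
  obtain ⟨d, hd⟩ := ((hK.prod hK).image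
    ((seminorm_continuous N).comp (continuous_fst.sub continuous_snd))).bddAbove
  exact ⟨d, fun x hx y hy => hd ⟨(x, y), ⟨hx, hy⟩, rfl⟩⟩

lemma diamLE_diam (hK : IsCompact K) : DiamLE N K (diam N K) := by
  obtain ⟨d, hd⟩ := exists_diamLE (N := N) hK
  exact fun x hx y hy => hd.le_diam hx hy

lemma diamLE_closedBall (c : E n) (r : ℝ) : DiamLE N (N.closedBall c r) (2 * r) := by
  intro x hx y hy
  rw [Seminorm.mem_closedBall] at hx hy
  have := map_sub_le_add N (x - c) (y - c)
  rw [sub_sub_sub_cancel_right] at this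
  linarith

lemma DiamLE.convexHull (h : DiamLE N K d) : DiamLE N (convexHull ℝ K) d := by
  have h1 : ∀ y ∈ K, ∀ x ∈ _root_.convexHull ℝ K, N (x - y) ≤ d := fun y hy x hx =>
    (N.mem_closedBall).1 (convexHull_min (fun z hz => (N.mem_closedBall).2 (h z hz y hy))
      (N.convex_closedBall y d) hx)
  intro x hx y hy
  rw [map_sub_rev]
  exact (N.mem_closedBall).1 (convexHull_min (fun z hz => (N.mem_closedBall).2 (by
    rw [map_sub_rev]; exact h1 z hz x hx)) (N.convex_closedBall x d) hy)

/-- Inserting `x` leaves the diameter unchanged exactly when `x` is within the diameter of every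
point of `K`. In this form, membership in a complete body is checked by distance estimates alone. -/
lemma isCompleteBody_iff : IsCompleteBody N K ↔ IsDiamMaximal N (diam N K) K := by
  constructor
  · rintro ⟨hK, h⟩
    refine ⟨hK, diamLE_diam hK.2.1, fun x hx => ?_⟩
    by_contra hxK
    refine (h x hxK).not_ge (DiamLE.diam_le ?_ (Set.insert_nonempty _ _))
    have hD : DiamLE N K (diam N K) := diamLE_diam hK.2.1
    have h0 : 0 ≤ diam N K := by
      obtain ⟨y, hy⟩ := hK.2.2
      exact (apply_nonneg N (y - y)).trans (hD y hy y hy)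
    rintro a (rfl | ha) b (rfl | hb)
    · simpa using h0
    · exact hx b hb
    · rw [map_sub_rev]; exact hx a ha
    · exact hD a ha b hb
  · rintro ⟨hK, -, h⟩
    refine ⟨hK, fun x hxK => ?_⟩
    by_contra hlt
    refine hxK (h x fun y hy => le_trans ?_ (not_lt.1 hlt))
    exact (diamLE_diam (hK.2.1.insert x)) x (Set.mem_insert _ _) y (Set.mem_insert_of_mem _ hy)

lemma IsDiamMaximal.isCompleteBody (h : IsDiamMaximal N d K) (hd : diam N K = d) :
    IsCompleteBody N K :=
  isCompleteBody_iff.2 (hd.symm ▸ h)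

lemma IsDiamMaximal.isCompletion (h : IsDiamMaximal N (diam N T) K) (hT : T ⊆ K)
    (hne : T.Nonempty) : IsCompletion N T K :=
  have hd := h.2.1.diam_eq hT hne le_rfl
  ⟨hT, h.isCompleteBody hd, hd⟩

lemma IsCompletion.isDiamMaximal (h : IsCompletion N T K) : IsDiamMaximal N (diam N T) K :=
  h.2.2 ▸ isCompleteBody_iff.1 h.2.1

/-- Every set of diameter at most `d` lies in a maximal one. -/
lemma exists_isDiamMaximal (hN : ∀ x, N x = 0 → x = 0) (hX : DiamLE N X d) (hne : X.Nonempty) :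
    ∃ K, X ⊆ K ∧ IsDiamMaximal N d K := by
  obtain ⟨K, hXK, hK⟩ := zorn_subset_nonempty {K | DiamLE N K d} (by
    intro c hc hchain hcne
    refine ⟨⋃₀ c, ?_, fun s hs => Set.subset_sUnion_of_mem hs⟩
    rintro x ⟨s, hs, hxs⟩ y ⟨t, ht, hyt⟩
    rcases hchain.total hs ht with hst | hst
    · exact hc ht x (hst hxs) y hyt
    · exact hc hs x hxs y (hst hyt)) X hX
  have hKd : DiamLE N K d := hK.prop
  obtain ⟨x₀, hx₀⟩ := hne.mono hXK
  have hd0 : 0 ≤ d := (apply_nonneg N _).trans (hKd x₀ hx₀ x₀ hx₀)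
  have hmem : ∀ x, (∀ y ∈ K, N (x - y) ≤ d) → x ∈ K := by
    intro x hx
    have h1 : DiamLE N (insert x K) d := by
      rintro a (rfl | ha) b (rfl | hb)
      · simpa using hd0
      · exact hx b hb
      · rw [map_sub_rev]; exact hx a ha
      · exact hKd a ha b hb
    exact hK.le_of_ge h1 (Set.subset_insert _ _) (Set.mem_insert _ _)
  -- Zorn's lemma was applied to arbitrary sets; maximality makes the result an intersection of
  -- balls, which gives convexity and compactness for free.
  have hKeq : K = ⋂ y ∈ K, N.closedBall y d := by
    ext x
    simp only [Set.mem_iInter, Seminorm.mem_closedBall]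
    exact ⟨fun hx y hy => hKd x hx y hy, hmem x⟩
  refine ⟨K, hXK, ⟨?_, ?_, x₀, hx₀⟩, hKd, hmem⟩
  · rw [hKeq]
    exact convex_iInter₂ fun y _ => N.convex_closedBall y d
  · refine (isCompact_seminorm_closedBall hN x₀ d).of_isClosed_subset ?_
      fun x hx => (N.mem_closedBall).2 (hKd x hx x₀ hx₀)
    rw [hKeq]
    exact isClosed_biInter fun y _ => (isCompact_seminorm_closedBall hN y d).isClosed

/-- By the triangle inequality through `c`, a point within `d - R` of `c` is within `d` of all of
`K`, and maximality then admits it. -/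
lemma IsDiamMaximal.ball_sub (h : IsDiamMaximal N d K) (hK : K ⊆ N.closedBall c R) :
    N.closedBall c (d - R) ⊆ K := by
  refine fun x hx => h.2.2 x fun y hy => ?_
  have h1 := (N.mem_closedBall).1 hx
  have h2 := (N.mem_closedBall).1 (hK hy)
  have := map_sub_le_add N (x - c) (y - c)
  rw [sub_sub_sub_cancel_right] at this
  linarith

lemma IsDiamMaximal.isTight (h : IsDiamMaximal N d K) (hT : T ⊆ K) (hK : K ⊆ N.closedBall c R) :
    IsTight N T c d R K :=
  ⟨h.1.1, hT, h.ball_sub hK, hK, h.2.1⟩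

/-- A point at distance `N (y - c) + ρ` from `y` in the ball of radius `ρ` about `c`. -/
lemma seminorm_add_le_of_ball_sub {y : E n} {ρ : ℝ} (hρ : 0 ≤ ρ) (hy : N (y - c) ≠ 0)
    (h : ∀ x ∈ N.closedBall c ρ, N (y - x) ≤ d) : N (y - c) + ρ ≤ d := by
  set t := N (y - c)
  have ht : 0 < t := lt_of_le_of_ne (apply_nonneg N _) (Ne.symm hy)
  -- The point of the ball opposite to `y`, for which the triangle inequality through `c` is an
  -- equality.
  have h1 := h (c - (ρ / t) • (y - c)) (by
    rw [Seminorm.mem_closedBall, sub_sub_cancel_left, map_neg_eq_map, map_smul_eq_mul,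
      Real.norm_of_nonneg (by positivity)]
    change ρ / t * t ≤ ρ
    rw [div_mul_cancel₀ _ ht.ne'])
  have h2 : y - (c - (ρ / t) • (y - c)) = (1 + ρ / t) • (y - c) := by module
  rw [h2, map_smul_eq_mul, Real.norm_of_nonneg (by positivity)] at h1
  change (1 + ρ / t) * t ≤ d at h1
  rwa [add_mul, one_mul, div_mul_cancel₀ _ ht.ne'] at h1

/-- A set of diameter at most `d` containing a ball of radius `d - R` lies in the concentric ball
of radius `R`. -/
lemma DiamLE.sub_ball (h : DiamLE N K d) (hR : 0 ≤ R) (hd : R ≤ d)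
    (hK : N.closedBall c (d - R) ⊆ K) : K ⊆ N.closedBall c R := by
  intro y hy
  rw [Seminorm.mem_closedBall]
  by_cases h0 : N (y - c) = 0
  · rwa [h0]
  · have := seminorm_add_le_of_ball_sub (d := d) (sub_nonneg.2 hd) h0
      fun x hx => h y hy x (hK hx)
    linarith

/-- Adding the concentric ball of radius `d - R` to a subset of the ball of radius `R` does not
raise the diameter above `d`. -/
lemma DiamLE.union_closedBall (h : DiamLE N X d) (hX : X ⊆ N.closedBall c R) (hd : d ≤ 2 * R) :
    DiamLE N (X ∪ N.closedBall c (d - R)) d := by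
  have key : ∀ x ∈ X, ∀ y ∈ N.closedBall c (d - R), N (x - y) ≤ d := by
    intro x hx y hy
    have h3 := (N.mem_closedBall).1 (hX hx)
    have h4 := (N.mem_closedBall).1 hy
    have := map_sub_le_add N (x - c) (y - c)
    rw [sub_sub_sub_cancel_right] at this
    linarith
  rintro x (hx | hx) y (hy | hy)
  · exact h x hx y hy
  · exact key x hx y hy
  · rw [map_sub_rev]; exact key y hy x hx
  · exact (diamLE_closedBall c _ x hx y hy).trans (by linarith)

/-- A set of diameter at most `d` in a ball of radius `R` lies in a maximal one in that ball. -/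
lemma exists_isDiamMaximal_subset (hN : ∀ x, N x = 0 → x = 0) (h : DiamLE N X d)
    (hne : X.Nonempty) (hX : X ⊆ N.closedBall c R) (hR : R ≤ d) (hd : d ≤ 2 * R) :
    ∃ K, X ⊆ K ∧ IsDiamMaximal N d K ∧ K ⊆ N.closedBall c R := by
  obtain ⟨K, hXK, hK⟩ := exists_isDiamMaximal hN (h.union_closedBall hX hd)
    (hne.mono Set.subset_union_left)
  exact ⟨K, Set.subset_union_left.trans hXK, hK,
    hK.2.1.sub_ball (by linarith) hR (Set.subset_union_right.trans hXK)⟩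

lemma RadiusGE.smul (h : RadiusGE N T R) : RadiusGE N ((2 : ℝ) • T) (2 * R) := by
  intro c ρ hT
  have : R ≤ ρ / 2 := by
    refine h ((2⁻¹ : ℝ) • c) _ fun x hx => ?_
    have h1 := (N.mem_closedBall).1 (hT (Set.smul_mem_smul_set hx))
    have h2 : x - (2⁻¹ : ℝ) • c = (2⁻¹ : ℝ) • ((2 : ℝ) • x - c) := by module
    rw [Seminorm.mem_closedBall, h2, map_smul_eq_mul, Real.norm_of_nonneg (by norm_num)]
    linarith
  linarith

namespace IsTight

/-- Each bound is additive or homogeneous, so the sum is tight with every parameter doubled. The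
ratio `R / (d - R)` does not change, which is the source of equality for the asymmetry of sums. -/
lemma add (hX : IsTight N T c d R X) (hY : IsTight N T c d R Y) :
    IsTight N ((2 : ℝ) • T) ((2 : ℝ) • c) (2 * d) (2 * R) (X + Y) where
  convex := hX.convex.add hY.convex
  sub := by
    rintro _ ⟨x, hx, rfl⟩
    exact ⟨x, hX.sub hx, x, hY.sub hx, (two_smul ℝ x).symm⟩
  ball_sub := by
    intro x hx
    have h1 : (2⁻¹ : ℝ) • x ∈ N.closedBall c (d - R) := by
      have h2 : (2⁻¹ : ℝ) • x - c = (2⁻¹ : ℝ) • (x - (2 : ℝ) • c) := by module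
      rw [Seminorm.mem_closedBall] at hx ⊢
      rw [h2, map_smul_eq_mul, Real.norm_of_nonneg (by norm_num)]
      linarith
    exact ⟨_, hX.ball_sub h1, _, hY.ball_sub h1, by module⟩
  sub_ball := by
    rintro _ ⟨x, hx, y, hy, rfl⟩
    have h1 := (N.mem_closedBall).1 (hX.sub_ball hx)
    have h2 := (N.mem_closedBall).1 (hY.sub_ball hy)
    rw [Seminorm.mem_closedBall]
    have h3 : x + y - (2 : ℝ) • c = (x - c) + (y - c) := by module
    change N (x + y - (2 : ℝ) • c) ≤ _
    rw [h3]
    linarith [map_add_le_add N (x - c) (y - c)]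
  diamLE := by
    rintro _ ⟨x, hx, y, hy, rfl⟩ _ ⟨x', hx', y', hy', rfl⟩
    have h1 := hX.diamLE x hx x' hx'
    have h2 := hY.diamLE y hy y' hy'
    change N (x + y - (x' + y')) ≤ _
    rw [add_sub_add_comm]
    linarith [map_add_le_add N (x - x') (y - y')]

lemma circumradius_eq (hX : IsTight N T c d R X) (hT : RadiusGE N T R) (hR : 0 < R) :
    circumradius N X = R := by
  refine le_antisymm (csInf_le ⟨0, fun ρ h => h.1.le⟩ ⟨hR, c, hX.sub_ball⟩) ?_
  refine le_csInf ⟨R, hR, c, hX.sub_ball⟩ ?_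
  rintro ρ ⟨-, c', h⟩
  exact hT c' ρ (hX.sub.trans h)

/-- A ball of radius `ρ` about `c'` inside `X` keeps every point of `X` within `d - ρ` of `c'`,
since the opposite point of the ball is at most `d` away. Hence `R ≤ d - ρ`. -/
lemma inradius_eq (hX : IsTight N T c d R X) (hT : RadiusGE N T R) (hR : 0 < R) (hd : R < d) :
    inradius N X = d - R := by
  have key : ∀ ρ ∈ {ρ : ℝ | 0 < ρ ∧ ∃ c : E n, N.closedBall c ρ ⊆ X}, ρ ≤ d - R := by
    rintro ρ ⟨hρ, c', h⟩
    have h1 : ∀ y ∈ X, N (y - c') ≠ 0 → N (y - c') + ρ ≤ d := fun y hy hy0 =>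
      seminorm_add_le_of_ball_sub hρ.le hy0 fun x hx => hX.diamLE y hy x (h hx)
    -- If `ρ > d`, no point of `T` could be at positive distance from `c'`, so `T` would lie in a
    -- ball of radius zero.
    have hρd : ρ ≤ d := by
      by_contra hlt
      refine hR.not_ge (hT c' 0 fun y hy => (N.mem_closedBall).2 ?_)
      by_contra h0
      have h2 := h1 y (hX.sub hy) (fun h => h0 h.le)
      linarith [apply_nonneg N (y - c')]
    have : R ≤ d - ρ := hT c' _ fun y hy => (N.mem_closedBall).2 (by
      by_cases h0 : N (y - c') = 0
      · rw [h0]; linarith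
      · linarith [h1 y (hX.sub hy) h0])
    linarith
  have hmem : d - R ∈ {ρ : ℝ | 0 < ρ ∧ ∃ c : E n, N.closedBall c ρ ⊆ X} :=
    ⟨by linarith, c, hX.ball_sub⟩
  exact le_antisymm (csSup_le ⟨_, hmem⟩ key) (le_csSup ⟨_, key⟩ hmem)

/-- The two concentric balls give the upper bound. Conversely, `-X ⊆ c' + σ X` places `T` in a ball
of radius `σ d / (1 + σ)`, and `R ≤ σ d / (1 + σ)` rearranges to `R / (d - R) ≤ σ`. -/
lemma asymmetry_eq (hX : IsTight N T c d R X) (hT : RadiusGE N T R) (hR : 0 < R) (hd : R < d) :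
    asymmetry X = R / (d - R) := by
  have hr : 0 < d - R := by linarith
  have hmem : R / (d - R) ∈ {ρ : ℝ | 0 < ρ ∧ ∃ c : E n, -X ⊆ c +ᵥ ρ • X} := by
    refine ⟨by positivity, -c - (R / (d - R)) • c, fun x hx => ?_⟩
    have h1 := (N.mem_closedBall).1 (hX.sub_ball (Set.mem_neg.1 hx))
    refine ⟨(R / (d - R)) • (c - ((d - R) / R) • (-x - c)),
      Set.smul_mem_smul_set (hX.ball_sub ?_), ?_⟩
    · rw [Seminorm.mem_closedBall, sub_sub_cancel_left, map_neg_eq_map, map_smul_eq_mul,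
        Real.norm_of_nonneg (by positivity), div_mul_eq_mul_div, div_le_iff₀ hR]
      exact mul_le_mul_of_nonneg_left h1 hr.le
    · have h2 : R / (d - R) * ((d - R) / R) = 1 := by field_simp
      simp only [vadd_eq_add]
      rw [smul_sub, smul_smul, h2]
      module
  refine le_antisymm (csInf_le ⟨0, fun ρ h => h.1.le⟩ hmem) (le_csInf ⟨_, hmem⟩ ?_)
  rintro σ ⟨hσ, c', h⟩
  have hσ1 : 0 < 1 + σ := by linarith
  have : R ≤ σ / (1 + σ) * d := by
    -- The centre is the fixed point of `z ↦ -(c' + σ z)`. If `x` is the image of `z`, then `x`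
    -- minus this point is `σ / (1 + σ)` times `x - z`.
    refine hT (-(1 / (1 + σ)) • c') _ fun x hx => ?_
    obtain ⟨_, ⟨z, hz, rfl⟩, hz2⟩ := h (Set.neg_mem_neg.2 (hX.sub hx))
    have hz3 : x = -(c' + σ • z) := by
      rw [eq_neg_iff_add_eq_zero, ← neg_eq_iff_add_eq_zero]; exact hz2.symm
    have h3 : x - -(1 / (1 + σ)) • c' = (σ / (1 + σ)) • (x - z) := by
      have h4 : (1 + σ) • (x - -(1 / (1 + σ)) • c') = (1 + σ) • ((σ / (1 + σ)) • (x - z)) := by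
        rw [smul_smul, mul_div_cancel₀ _ hσ1.ne', smul_sub, neg_smul, smul_neg, smul_smul,
          mul_one_div_cancel hσ1.ne', one_smul, add_smul, one_smul]
        nth_rewrite 1 [hz3]
        module
      exact smul_right_injective _ hσ1.ne' h4
    rw [Seminorm.mem_closedBall, h3, map_smul_eq_mul, Real.norm_of_nonneg (by positivity)]
    gcongr
    exact hX.diamLE x (hX.sub hx) z hz
  rw [div_le_iff₀ hr]
  rw [div_mul_eq_mul_div, le_div_iff₀ hσ1] at this
  linarith

/-- Central symmetry would make the asymmetry at most one, whereas `d < 2 * R` gives `R / (d - R) >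
1`. -/
lemma not_symm (hX : IsTight N T c d R X) (hT : RadiusGE N T R) (hR : d < 2 * R) (hd : R < d) :
    ¬ IsCentrallySymmetric X := by
  rintro ⟨p, hp⟩
  have hR0 : 0 < R := by linarith
  have h1 : asymmetry X ≤ 1 := by
    refine csInf_le ⟨0, fun ρ h => h.1.le⟩ ⟨one_pos, -(2 : ℝ) • p, fun x hx => ?_⟩
    refine ⟨(2 : ℝ) • p - -x, by rw [one_smul]; exact hp _ hx, ?_⟩
    simp only [vadd_eq_add]
    module
  rw [hX.asymmetry_eq hT hR0 hd, div_le_one (by linarith)] at h1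
  linarith

lemma diam_eq (hX : IsTight N T c d R X) (hne : T.Nonempty) (hd : d ≤ diam N T) :
    diam N X = d := hX.diamLE.diam_eq hX.sub hne hd

end IsTight

lemma diam_smul_two (hT : DiamLE N T d) (hne : T.Nonempty) :
    2 * diam N T ≤ diam N ((2 : ℝ) • T) := by
  have h2 : ∀ x y : E n, N ((2 : ℝ) • x - (2 : ℝ) • y) = 2 * N (x - y) := fun x y => by
    rw [← smul_sub, map_smul_eq_mul, Real.norm_of_nonneg (by norm_num)]
  have h : DiamLE N ((2 : ℝ) • T) (2 * d) := by
    rintro _ ⟨x, hx, rfl⟩ _ ⟨y, hy, rfl⟩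
    change N ((2 : ℝ) • x - (2 : ℝ) • y) ≤ _
    linarith [h2 x y, hT x hx y hy]
  have : diam N T ≤ diam N ((2 : ℝ) • T) / 2 := by
    refine DiamLE.diam_le (fun x hx y hy => ?_) hne
    have := h.le_diam (Set.smul_mem_smul_set hx) (Set.smul_mem_smul_set hy)
    rw [h2] at this
    linarith
  linarith

lemma isCompact_convexHull_union {A B : Set (E n)} (hA : IsConvexBody A) (hB : IsConvexBody B) :
    IsConvexBody (convexHull ℝ (A ∪ B)) := by
  refine ⟨convex_convexHull ℝ _, ?_, (hA.2.2.mono Set.subset_union_left).convexHull⟩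
  rw [convexHull_union hA.2.2 hB.2.2, hA.1.convexHull_eq, hB.1.convexHull_eq]
  have : convexJoin ℝ A B = (fun p : ℝ × E n × E n => (1 - p.1) • p.2.1 + p.1 • p.2.2) ''
      (Set.Icc 0 1 ×ˢ A ×ˢ B) := by
    ext x
    simp only [mem_convexJoin, segment_eq_image, Set.mem_image, Set.mem_prod, Prod.exists]
    constructor
    · rintro ⟨a, ha, b, hb, t, ht, rfl⟩
      exact ⟨t, a, b, ⟨ht, ha, hb⟩, rfl⟩
    · rintro ⟨t, a, b, ⟨ht, ha, hb⟩, rfl⟩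
      exact ⟨a, ha, b, hb, t, ht, rfl⟩
  rw [this]
  exact (isCompact_Icc.prod (hA.2.1.prod hB.2.1)).image (by fun_prop)

end PropB

/-! ### No similarity between nested bodies -/

namespace PropB
variable {n : ℕ} {N : Seminorm ℝ (E n)} {T X Y K P : Set (E n)} {c : E n} {d R : ℝ}

/-- A compact set is not moved into a smaller closed subset by a noncontracting map. -/
lemma subset_of_noncontracting (hN : ∀ x, N x = 0 → x = 0) (hK : IsCompact K) (hP : IsClosed P)
    (hPK : P ⊆ K) (g : E n → E n) (hg : ∀ x ∈ K, g x ∈ P)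
    (hexp : ∀ x ∈ K, ∀ y ∈ K, N (x - y) ≤ N (g x - g y)) : K ⊆ P := by
  intro x hx
  by_contra hxP
  obtain ⟨ε, hε, hball⟩ := Metric.isOpen_iff.1 hP.isOpen_compl x hxP
  obtain ⟨C, hC, hCN⟩ := exists_norm_le hN
  obtain ⟨C', hC', hCN'⟩ := exists_seminorm_le N
  have hfar : ∀ p ∈ P, ε ≤ C * N (x - p) := by
    intro p hp
    refine le_trans ?_ (hCN _)
    by_contra hlt
    refine hball (Metric.mem_ball.2 ?_) hp
    rw [dist_comm, dist_eq_norm]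
    exact not_le.1 hlt
  have hit : ∀ k, g^[k] x ∈ K := by
    intro k
    induction k with
    | zero => exact hx
    | succ k ih => rw [Function.iterate_succ_apply']; exact hPK (hg _ ih)
  have hitP : ∀ k, g^[k + 1] x ∈ P := fun k => by
    rw [Function.iterate_succ_apply']; exact hg _ (hit k)
  -- Noncontraction transfers any near-return of the orbit to `x` itself. Compactness supplies
  -- near-returns, but all later iterates lie in `P`, at a definite distance from `x`.
  have hsep : ∀ k m, N (x - g^[k] x) ≤ N (g^[m] x - g^[m + k] x) := by
    intro k m
    induction m with
    | zero => simp
    | succ m ih =>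
      rw [show m + 1 + k = (m + k) + 1 by ring, Function.iterate_succ_apply' g m,
        Function.iterate_succ_apply' g (m + k)]
      exact ih.trans (hexp _ (hit _) _ (hit _))
  obtain ⟨z, -, φ, hφ, hlim⟩ := hK.tendsto_subseq hit
  have hlim0 : Filter.Tendsto (fun j => dist (g^[φ j] x) (g^[φ (j + 1)] x)) Filter.atTop
      (nhds 0) := by
    simpa using hlim.dist (hlim.comp (Filter.tendsto_add_atTop_nat 1))
  have hpos : 0 < ε / (C * C') := by positivity
  obtain ⟨j, hj⟩ := ((tendsto_order.1 hlim0).2 _ hpos).exists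
  obtain ⟨k, hk⟩ := Nat.exists_eq_add_of_lt (hφ (Nat.lt_succ_self j))
  have h1 := hsep (k + 1) (φ j)
  rw [← add_assoc, ← hk] at h1
  have h2 := hfar _ (hitP k)
  have h3 := hCN' (g^[φ j] x - g^[φ (j + 1)] x)
  rw [dist_eq_norm, lt_div_iff₀ (by positivity)] at hj
  have h4 : C * N (x - g^[k + 1] x) ≤ C * (C' * ‖g^[φ j] x - g^[φ (j + 1)] x‖) := by
    gcongr
    exact h1.trans h3
  nlinarith

/-- A similarity of ratio at most one does not map a closed set onto a larger compact set. -/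
lemma eq_of_similarity_le_one (hN : ∀ x, N x = 0 → x = 0) (hK : IsCompact K) (hP : IsClosed P)
    (hPK : P ⊆ K) {f : E n → E n} {ρ : ℝ} (hρ1 : ρ ≤ 1)
    (hf : ∀ x y, N (f x - f y) = ρ * N (x - y)) (hfP : f '' P = K) : P = K := by
  refine hPK.antisymm ?_
  have : ∀ y, ∃ x, y ∈ K → x ∈ P ∧ f x = y := by
    intro y
    by_cases hy : y ∈ K
    · obtain ⟨x, hx⟩ := hfP.symm ▸ hy
      exact ⟨x, fun _ => hx⟩
    · exact ⟨0, fun h => absurd h hy⟩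
  choose g hg using this
  refine subset_of_noncontracting hN hK hP hPK g (fun x hx => (hg x hx).1) fun x hx y hy => ?_
  have := hf (g x) (g y)
  rw [(hg x hx).2, (hg y hy).2] at this
  rw [this]
  nlinarith [apply_nonneg N (g x - g y)]

/-- The dual characterization of the circumradius of a finite set. -/
lemma exists_dual_of_radiusGE {ι : Type*} [Fintype ι] [Nonempty ι] {v : ι → E n}
    (hR : 0 < R) (h : RadiusGE N (Set.range v) R) :
    ∃ φ : ι → E n →ₗ[ℝ] ℝ, (∀ x, ∑ i, φ i x = 0) ∧
      (∀ b : ι → E n, (∀ i, N (b i) ≤ 1) → ∑ i, φ i (b i) ≤ 1) ∧ R ≤ ∑ i, φ i (v i) := by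
  classical
  have hs : IsOpen {x : ι → E n | ∀ i, N (x i) < R} := by
    simp only [Set.ofPred_forall]
    exact isOpen_iInter_of_finite fun i =>
      isOpen_lt ((seminorm_continuous N).comp (continuous_apply i)) continuous_const
  have hsc : Convex ℝ {x : ι → E n | ∀ i, N (x i) < R} := by
    intro x hx y hy a b ha hb hab i
    have : N (a • x i + b • y i) < R := by
      have h0 := N.convex_ball 0 R ((N.mem_ball_zero).2 (hx i)) ((N.mem_ball_zero).2 (hy i))
        ha hb hab
      exact (N.mem_ball_zero).1 h0
    exact this
  have ht : Convex ℝ (Set.range fun c : E n => fun i => v i - c) := by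
    rintro _ ⟨x, rfl⟩ _ ⟨y, rfl⟩ a b ha hb hab
    refine ⟨a • x + b • y, ?_⟩
    ext1 i
    have : v i = (a + b) • v i := by rw [hab, one_smul]
    simp only [Pi.add_apply, Pi.smul_apply]
    rw [this]
    rw [hab, one_smul]
    nth_rewrite 1 [this]
    module
  have hdisj : Disjoint {x : ι → E n | ∀ i, N (x i) < R}
      (Set.range fun c : E n => fun i => v i - c) := by
    rw [Set.disjoint_left]
    rintro _ hx ⟨c, rfl⟩
    obtain ⟨i₀, hi₀⟩ := Finite.exists_max fun i => N (v i - c)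
    refine (h c (N (v i₀ - c)) ?_).not_gt (hx i₀)
    rintro _ ⟨i, rfl⟩
    exact (N.mem_closedBall).2 (hi₀ i)
  -- In the product space, the open max-norm ball of radius `R` misses the translates of `v` along
  -- the diagonal, because no ball of radius below `R` contains all the `v i`.
  obtain ⟨f, u, hfs, hft⟩ := geometric_hahn_banach_open hsc hs ht hdisj
  have hu : 0 < u := by simpa using hfs 0 (by intro i; simpa using hR)
  have hv : u ≤ f v := by simpa using hft v ⟨0, by simp⟩
  have hdiag : ∀ c : E n, f (fun _ => c) = 0 := by
    intro c
    by_contra hne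
    -- If `f` did not vanish on the diagonal, a translate of `v` would have value `-1`, below the
    -- positive level `u`.
    have h1 : u ≤ f (fun i => v i - ((f v + 1) / f (fun _ => c)) • c) :=
      hft _ ⟨((f v + 1) / f (fun _ => c)) • c, rfl⟩
    have h2 : (fun i => v i - ((f v + 1) / f (fun _ => c)) • c) =
        v - ((f v + 1) / f (fun _ => c)) • (fun _ => c : ι → E n) := rfl
    rw [h2, map_sub, map_smul, smul_eq_mul, div_mul_cancel₀ _ hne] at h1
    linarith
  have hsum : ∀ b : ι → E n, f b = ∑ i, f (Pi.single i (b i)) := by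
    intro b
    rw [← map_sum, Finset.univ_sum_single]
  refine ⟨fun i => (R / u) • (f.toLinearMap ∘ₗ LinearMap.single ℝ (fun _ => E n) i), ?_, ?_, ?_⟩
  · intro x
    have := hsum fun _ => x
    simp [← Finset.mul_sum, ← this, hdiag]
  · intro b hb
    have h1 : f b ≤ u / R := by
      by_contra hlt
      rw [not_le, div_lt_iff₀ hR] at hlt
      have hfb : 0 < f b := by
        by_contra h0
        nlinarith
      have h2 := hfs ((u / f b) • b) fun i => by
        rw [Pi.smul_apply, map_smul_eq_mul, Real.norm_of_nonneg (by positivity)]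
        have : u / f b < R := by rw [div_lt_iff₀ hfb]; linarith
        have hpos : 0 < u / f b := by positivity
        nlinarith [hb i, apply_nonneg N (b i)]
      rw [map_smul, smul_eq_mul, div_mul_cancel₀ _ hfb.ne'] at h2
      exact lt_irrefl _ h2
    have h3 := hsum b
    simp only [LinearMap.smul_apply, LinearMap.comp_apply, smul_eq_mul, ← Finset.mul_sum]
    change R / u * ∑ i, f (Pi.single i (b i)) ≤ 1
    rw [← h3, div_mul_eq_mul_div, div_le_one hu]
    rw [le_div_iff₀ hR] at h1
    linarith
  · have h3 := hsum v
    simp only [LinearMap.smul_apply, LinearMap.comp_apply, smul_eq_mul, ← Finset.mul_sum]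
    change R ≤ R / u * ∑ i, f (Pi.single i (v i))
    rw [← h3, div_mul_eq_mul_div, le_div_iff₀ hu]
    nlinarith

/-- Let `P ⊆ K` contain a ball of radius `d - R` and a set of circumradius at least `R`, where `K`
has diameter at most `d`. Then no expanding Euclidean similarity maps `P` onto `K`. -/
lemma not_image_eq_of_expanding {ι : Type*} [Fintype ι] [Nonempty ι] {v : ι → E n}
    (hR : 0 < R) (hd : R < d) (hv : RadiusGE N (Set.range v) R) (hvP : Set.range v ⊆ P)
    (hball : N.closedBall c (d - R) ⊆ P) (hPK : P ⊆ K) (hK : DiamLE N K d)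
    {L : E n →ₗ[ℝ] E n} {a : E n} {ρ : ℝ} (hρ : 1 < ρ)
    (hL : ∀ x, ‖L x‖ = ρ * ‖x‖) : (fun x => a + L x) '' P ≠ K := by
  intro hf
  obtain ⟨φ, h0, hb, hφ⟩ := exists_dual_of_radiusGE hR hv
  have hmaps : ∀ x ∈ P, a + L x ∈ K := fun x hx => hf ▸ ⟨x, hx, rfl⟩
  -- The functionals `φ i ∘ L ^ k` keep dual norm at most one and keep value at least `R` on some
  -- tuple `p` in `P`. To advance, test `φ i ∘ L ^ k` on `p i - f (c - (d - R) b i)`, where `f x = a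
  -- + L x`: both points lie in `K`, so `R + (d - R) ∑ φ i (L ^ (k+1) (b i)) ≤ d`. The new tuple
  -- consists of preimages of the `p i` under `f`; translations drop out since the `φ i` sum to
  -- zero.
  have key : ∀ k : ℕ, (∀ b : ι → E n, (∀ i, N (b i) ≤ 1) → ∑ i, φ i ((L ^ k) (b i)) ≤ 1) ∧
      (∃ p : ι → E n, (∀ i, p i ∈ P) ∧ R ≤ ∑ i, φ i ((L ^ k) (p i))) := by
    intro k
    induction k with
    | zero => exact ⟨by simpa using hb, v, fun i => hvP ⟨i, rfl⟩, by simpa using hφ⟩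
    | succ k ih =>
      obtain ⟨ih1, p, hp, ih2⟩ := ih
      have hz : ∀ x, ∑ i, φ i ((L ^ k) x) = 0 := fun x => h0 _
      constructor
      · intro b hb1
        have hy : ∀ i, a + L (c - (d - R) • b i) ∈ K := fun i => hmaps _ (hball (by
          rw [Seminorm.mem_closedBall, sub_sub_cancel_left, map_neg_eq_map, map_smul_eq_mul,
            Real.norm_of_nonneg (by linarith)]
          nlinarith [hb1 i]))
        have h1 := ih1 (fun i => (1 / d) • (p i - (a + L (c - (d - R) • b i)))) fun i => by
          have hd0 : 0 < d := hR.trans hd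
          rw [map_smul_eq_mul, Real.norm_of_nonneg (by positivity), one_div_mul_eq_div,
            div_le_one hd0]
          exact hK _ (hPK (hp i)) _ (hy i)
        have h2 : ∀ i, φ i ((L ^ k) ((1 / d) • (p i - (a + L (c - (d - R) • b i))))) =
            (1 / d) * (φ i ((L ^ k) (p i)) - φ i ((L ^ k) (a + L c)) +
              (d - R) * φ i ((L ^ (k + 1)) (b i))) := by
          intro i
          simp only [pow_succ, Module.End.mul_apply, map_smul, map_sub, map_add, smul_eq_mul]
          ring
        simp only [h2, ← Finset.mul_sum, Finset.sum_add_distrib, Finset.sum_sub_distrib, hz] at h1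
        rw [one_div_mul_eq_div, div_le_one (by linarith)] at h1
        nlinarith
      · have : ∀ i, ∃ q ∈ P, a + L q = p i := fun i => by
          have : p i ∈ (fun x => a + L x) '' P := hf ▸ hPK (hp i)
          exact this
        choose q hq hqp using this
        refine ⟨q, hq, ih2.trans (le_of_eq ?_)⟩
        have h2 : ∀ i, φ i ((L ^ (k + 1)) (q i)) = φ i ((L ^ k) (p i)) - φ i ((L ^ k) a) := by
          intro i
          rw [← hqp i]
          simp only [pow_succ, Module.End.mul_apply, map_add]
          ring
        simp only [h2, Finset.sum_sub_distrib, hz, sub_zero]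
  have hLk : ∀ (k : ℕ) (x : E n), ‖(L ^ k) x‖ = ρ ^ k * ‖x‖ := by
    intro k
    induction k with
    | zero => simp
    | succ k ih => intro x; rw [pow_succ', Module.End.mul_apply, hL, ih, pow_succ]; ring
  have hLinj : ∀ k : ℕ, Function.Injective (L ^ k) := fun k => by
    rw [injective_iff_map_eq_zero]
    intro x hx
    have h1 := hLk k x
    rw [hx, norm_zero] at h1
    have : ρ ^ k ≠ 0 := by positivity
    simpa [this] using h1.symm
  have hLsurj : ∀ k : ℕ, Function.Surjective (L ^ k) := fun k =>
    LinearMap.surjective_of_injective (hLinj k)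
  obtain ⟨i, z, hz⟩ : ∃ i z, 0 < φ i z := by
    by_contra! hcon
    have : ∑ i, φ i (v i) ≤ 0 := Finset.sum_nonpos fun i _ => hcon i _
    linarith
  obtain ⟨C, hC, hCN⟩ := exists_seminorm_le N
  have hz0 : 0 < ‖z‖ := norm_pos_iff.2 fun h => by simp [h] at hz
  classical
  -- Since `L ^ k` stretches Euclidean length by `ρ ^ k`, the preimage of a fixed `z` with `φ i z >
  -- 0` has length `‖z‖ / ρ ^ k`. The dual bound on it would bound all powers of `ρ`.
  have hbound : ∀ k : ℕ, ρ ^ k ≤ C * ‖z‖ / φ i z := by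
    intro k
    obtain ⟨w, hw⟩ := hLsurj k z
    have hwz : ‖z‖ = ρ ^ k * ‖w‖ := by rw [← hw, hLk]
    have hρk : 0 < ρ ^ k := by positivity
    have h1 := (key k).1 (Pi.single i ((ρ ^ k / (C * ‖z‖)) • w)) fun j => by
      by_cases hj : j = i
      · subst hj
        rw [Pi.single_eq_same, map_smul_eq_mul, Real.norm_of_nonneg (by positivity),
          div_mul_eq_mul_div, div_le_one (by positivity), hwz]
        nlinarith [hCN w]
      · rw [Pi.single_eq_of_ne hj, map_zero]; exact zero_le_one
    rw [Finset.sum_eq_single i (fun j _ hj => by simp [Pi.single_eq_of_ne hj]) (by simp),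
      Pi.single_eq_same, map_smul, map_smul, hw, smul_eq_mul, div_mul_eq_mul_div,
      div_le_one (by positivity)] at h1
    rwa [le_div_iff₀ hz]
  obtain ⟨k, hk⟩ := pow_unbounded_of_one_lt (C * ‖z‖ / φ i z) hρ
  exact hk.not_ge (hbound k)

/-- A map multiplying Euclidean distances by a positive factor is affine. -/
lemma exists_linear_of_similarity {f : E n → E n} {ρ : ℝ} (hρ : 0 < ρ)
    (hf : ∀ x y, euclid n (f x - f y) = ρ * euclid n (x - y)) :
    ∃ U : E n →ₗᵢ[ℝ] E n, ∀ x, f x = f 0 + ρ • U x := by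
  have hi : Isometry fun x => ρ⁻¹ • f x := by
    refine Isometry.of_dist_eq fun x y => ?_
    have := hf x y
    simp only [coe_normSeminorm] at this
    rw [dist_eq_norm, dist_eq_norm, ← smul_sub, norm_smul, this, norm_inv,
      Real.norm_of_nonneg hρ.le, inv_mul_cancel_left₀ hρ.ne']
  refine ⟨hi.affineIsometryOfStrictConvexSpace.linearIsometry, fun x => ?_⟩
  have h1 := hi.affineIsometryOfStrictConvexSpace.map_vadd 0 x
  simp only [vadd_eq_add, add_zero, Isometry.coe_affineIsometryOfStrictConvexSpace] at h1
  have h2 := congrArg (fun y => ρ • y) h1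
  simp only [smul_add, smul_inv_smul₀ hρ.ne'] at h2
  rw [h2, add_comm]

lemma euclid_definite : ∀ x, euclid n x = 0 → x = 0 := fun _ hx => norm_eq_zero.1 hx

/-- Euclidean ratios are not controlled by the `N`-diameter, so ratios at most one and greater than
one need separate arguments: recurrence, and iteration of the linear part. -/
lemma not_areSimilar_euclid {ι : Type*} [Fintype ι] [Nonempty ι] {v : ι → E n}
    (hR : 0 < R) (hd : R < d) (hv : RadiusGE N (Set.range v) R) (hvP : Set.range v ⊆ P)
    (hball : N.closedBall c (d - R) ⊆ P) (hPK : P ⊆ K) (hne : P ≠ K) (hPc : IsClosed P)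
    (hKc : IsCompact K) (hK : DiamLE N K d) :
    ¬ AreSimilar (euclid n) P K := by
  rintro ⟨f, ρ, hρ, hf, hfP⟩
  rcases le_or_gt ρ 1 with hρ1 | hρ1
  · exact hne (eq_of_similarity_le_one euclid_definite hKc hPc hPK hρ1 hf hfP)
  · obtain ⟨U, hU⟩ := exists_linear_of_similarity hρ hf
    refine not_image_eq_of_expanding hR hd hv hvP hball hPK hK (L := ρ • U.toLinearMap)
      (a := f 0) hρ1 (fun x => ?_) ?_
    · simp [norm_smul, abs_of_pos hρ]
    · rw [← hfP]
      exact Set.image_congr fun x _ => (hU x).symm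

lemma not_areSimilar_self (hN : ∀ x, N x = 0 → x = 0) (hPK : P ⊆ K) (hne : P ≠ K)
    (hPc : IsClosed P) (hKc : IsCompact K) (hP0 : P.Nonempty) (hdP : diam N P = d)
    (hdK : diam N K = d) (hd : 0 < d) : ¬ AreSimilar N P K := by
  rintro ⟨f, ρ, hρ, hf, hfP⟩
  refine hne (eq_of_similarity_le_one hN hKc hPc hPK ?_ hf hfP)
  have hDK : DiamLE N K d := hdK ▸ diamLE_diam hKc
  have : diam N P ≤ d / ρ := by
    refine DiamLE.diam_le (fun x hx y hy => ?_) hP0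
    rw [le_div_iff₀ hρ, mul_comm, ← hf]
    exact hDK _ (hfP ▸ ⟨x, hx, rfl⟩) _ (hfP ▸ ⟨y, hy, rfl⟩)
  rw [hdP, le_div_iff₀ hρ] at this
  nlinarith

end PropB

/-! ### Pseudo completion and completions of a simplex in an arbitrary norm -/

namespace PropB
variable {n : ℕ} {N : Seminorm ℝ (E n)} {T X Y K P : Set (E n)} {c : E n} {d R : ℝ}

lemma radiusGE_circumradius (hne : T.Nonempty) : RadiusGE N T (circumradius N T) := by
  intro c ρ h
  obtain ⟨x, hx⟩ := hne
  have hρ : 0 ≤ ρ := (apply_nonneg N _).trans ((N.mem_closedBall).1 (h hx))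
  -- The infimum runs over positive radii only, while `ρ` may be zero.
  refine le_of_forall_pos_le_add fun ε hε => ?_
  refine csInf_le ⟨0, fun ρ h => h.1.le⟩ ⟨by linarith, c, h.trans ?_⟩
  exact Seminorm.closedBall_mono (by linarith)

lemma circumradius_le_diam (hT : IsConvexBody T) : circumradius N T ≤ diam N T := by
  obtain ⟨x, hx⟩ := hT.2.2
  exact radiusGE_circumradius hT.2.2 x _ fun y hy =>
    (N.mem_closedBall).2 (diamLE_diam hT.2.1 y hy x hx)

lemma diam_le_two_mul_circumradius (hT : IsConvexBody T) (hc : IsCircumcenter N T c) :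
    diam N T ≤ 2 * circumradius N T :=
  DiamLE.diam_le (fun x hx y hy => diamLE_closedBall c _ x (hc hx) y (hc hy)) hT.2.2

lemma isTight_pseudoCompletion (hT : IsConvexBody T) (hc : IsCircumcenter N T c) :
    IsTight N T c (diam N T) (circumradius N T) (pseudoCompletion N T c) := by
  have h2 := diam_le_two_mul_circumradius hT hc
  refine ⟨convex_convexHull ℝ _, Set.subset_union_left.trans (subset_convexHull ℝ _),
    Set.subset_union_right.trans (subset_convexHull ℝ _),
    convexHull_min (Set.union_subset hc (Seminorm.closedBall_mono (by linarith)))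
      (N.convex_closedBall _ _),
    ((diamLE_diam hT.2.1).union_closedBall hc h2).convexHull⟩

lemma isConvexBody_pseudoCompletion (hT : IsConvexBody T) (hN : ∀ x, N x = 0 → x = 0) :
    IsConvexBody (pseudoCompletion N T c) :=
  isCompact_convexHull_union hT ⟨N.convex_closedBall _ _, isCompact_seminorm_closedBall hN _ _,
    c, N.mem_closedBall_self (sub_nonneg.2 (circumradius_le_diam hT))⟩

/-- There is a completion inside a given circumball. -/
lemma exists_completion_subset (hT : IsConvexBody T) (hc : IsCircumcenter N T c)
    (hN : ∀ x, N x = 0 → x = 0) :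
    ∃ K, IsCompletion N T K ∧ K ⊆ N.closedBall c (circumradius N T) := by
  obtain ⟨K, hTK, hK, hKc⟩ := exists_isDiamMaximal_subset hN (diamLE_diam hT.2.1) hT.2.2 hc
    (circumradius_le_diam hT) (diam_le_two_mul_circumradius hT hc)
  exact ⟨K, hK.isCompletion hTK hT.2.2, hKc⟩

lemma IsCompletion.isTight (hK : IsCompletion N T K)
    (hKc : K ⊆ N.closedBall c (circumradius N T)) :
    IsTight N T c (diam N T) (circumradius N T) K :=
  hK.isDiamMaximal.isTight hK.1 hKc

lemma pseudoCompletion_subset (hK : IsCompletion N T K)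
    (hKc : K ⊆ N.closedBall c (circumradius N T)) : pseudoCompletion N T c ⊆ K :=
  convexHull_min (Set.union_subset hK.1 (hK.isTight hKc).ball_sub) hK.2.1.1.1

/-- If `D ≥ 2R`, the inner ball of radius `D - R` contains the circumball, so the pseudo completion
would swallow `K`. -/
lemma diam_lt_two_mul_circumradius (hT : IsConvexBody T) (hc : IsCircumcenter N T c)
    (hK : IsCompletion N T K)
    (hKc : K ⊆ N.closedBall c (circumradius N T)) (hne : pseudoCompletion N T c ≠ K) :
    diam N T < 2 * circumradius N T := by
  by_contra hlt
  refine hne ((pseudoCompletion_subset hK hKc).antisymm (hKc.trans ?_))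
  exact (Seminorm.closedBall_mono (by linarith)).trans (isTight_pseudoCompletion hT hc).ball_sub

section Body

variable (T : Affine.Simplex ℝ (E n) n)

lemma points_mem_body (i : Fin (n + 1)) : T.points i ∈ body T :=
  subset_convexHull ℝ _ ⟨i, rfl⟩

lemma isConvexBody_body : IsConvexBody (body T) :=
  ⟨convex_convexHull ℝ _, (Set.finite_range _).isCompact_convexHull ℝ, _, points_mem_body T 0⟩

variable {T}

lemma RadiusGE.range_of_body (h : RadiusGE N (body T) R) :
    RadiusGE N (Set.range T.points) R :=
  fun c ρ hc => h c ρ (convexHull_min hc (N.convex_closedBall _ _))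

lemma diam_body_pos (hN : ∀ x, N x = 0 → x = 0) (hn : 1 ≤ n) : 0 < diam N (body T) := by
  have h01 : (0 : Fin (n + 1)) ≠ Fin.last n := by
    intro h
    have := congrArg Fin.val h
    simp only [Fin.val_zero, Fin.val_last] at this
    omega
  refine lt_of_lt_of_le ?_ (diamLE_diam (isConvexBody_body T).2.1 _ (points_mem_body T 0) _
    (points_mem_body T (Fin.last n)))
  refine lt_of_le_of_ne (apply_nonneg N _) fun h => h01 (T.independent.injective ?_)
  exact sub_eq_zero.1 (hN _ h.symm)

/-- Bohnenblust's bound `R ≤ n D / (n + 1)`: from the centroid, each vertex is displaced by the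
average of `n + 1` differences, one of which is zero. -/
lemma circumradius_body_lt_diam (hN : ∀ x, N x = 0 → x = 0) (hn : 1 ≤ n) :
    circumradius N (body T) < diam N (body T) := by
  have hD := diam_body_pos (T := T) hN hn
  set D := diam N (body T)
  have hn1 : (0 : ℝ) < n + 1 := by positivity
  have h1 : circumradius N (body T) ≤ (1 / (n + 1 : ℝ)) * (n * D) := by
    refine (radiusGE_circumradius (isConvexBody_body T).2.2).range_of_body
      ((1 / (n + 1 : ℝ)) • ∑ j, T.points j) _ ?_
    rintro _ ⟨i, rfl⟩
    have h2 : T.points i - (1 / (n + 1 : ℝ)) • ∑ j, T.points j =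
        (1 / (n + 1 : ℝ)) • ∑ j, (T.points i - T.points j) := by
      rw [Finset.sum_sub_distrib, smul_sub]
      congr 1
      rw [Finset.sum_const, Finset.card_univ, Fintype.card_fin, ← Nat.cast_smul_eq_nsmul ℝ,
        smul_smul]
      push_cast
      rw [one_div_mul_cancel hn1.ne', one_smul]
    rw [Seminorm.mem_closedBall, h2, map_smul_eq_mul, Real.norm_of_nonneg (by positivity)]
    gcongr
    refine (Finset.le_sum_of_subadditive N (map_zero N).le (map_add_le_add N) _ _).trans ?_
    rw [← Finset.add_sum_erase _ _ (Finset.mem_univ i), sub_self, map_zero, zero_add]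
    refine (Finset.sum_le_card_nsmul _ _ D fun j _ => ?_).trans ?_
    · exact diamLE_diam (isConvexBody_body T).2.1 _ (points_mem_body T i) _ (points_mem_body T j)
    · simp [Finset.card_erase_of_mem]
  refine h1.trans_lt ?_
  rw [one_div_mul_eq_div, div_lt_iff₀ hn1]
  nlinarith

end Body

/-- The pseudo completion and a completion of a simplex behave alike for the asymmetry. -/
lemma pseudoCompletion_completion {T : Affine.Simplex ℝ (E n) n} (hN : ∀ x, N x = 0 → x = 0)
    (hc : IsCircumcenter N (body T) c)
    (hPc : ¬ IsCompleteBody N (pseudoCompletion N (body T) c))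
    (hP : P = pseudoCompletion N (body T) c)
    (hK : IsCompletion N (body T) K) (hKc : K ⊆ N.closedBall c (circumradius N (body T))) :
    IsConvexBody P ∧ IsConvexBody K ∧
    circumradius N (P + K) + inradius N (P + K) =
      circumradius N P + inradius N P + (circumradius N K + inradius N K) ∧
    circumradius N P + inradius N P + (circumradius N K + inradius N K) = diam N P + diam N K ∧
    diam N P + diam N K = diam N (P + K) ∧
    asymmetry (P + K) = circumradius N (P + K) / inradius N (P + K) ∧
    asymmetry (P + K) = asymmetry P ∧ asymmetry P = asymmetry K ∧
    ¬ IsCentrallySymmetric P ∧ ¬ IsCentrallySymmetric K ∧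
    ¬ AreSimilar N P K ∧ ¬ AreSimilar (euclid n) P K := by
  have hT := isConvexBody_body T
  have hne : P ≠ K := fun h => hPc (hP ▸ h ▸ hK.2.1)
  have hPK : P ⊆ K := hP ▸ pseudoCompletion_subset hK hKc
  have hPb : IsConvexBody P := hP ▸ isConvexBody_pseudoCompletion hT hN
  have hKb := hK.2.1.1
  -- In dimension zero both bodies are the single point, contradicting `P ≠ K`.
  have hn : 1 ≤ n := by
    by_contra h0
    obtain rfl : n = 0 := by omega
    obtain ⟨x, hx⟩ := hPb.2.2
    exact hne (hPK.antisymm fun y _ => Subsingleton.elim x y ▸ hx)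
  have h2R := diam_lt_two_mul_circumradius hT hc hK hKc (hP ▸ hne)
  have hRD := circumradius_body_lt_diam (T := T) hN hn
  have hD := diam_body_pos (T := T) hN hn
  have tP : IsTight N (body T) c _ _ P := hP ▸ isTight_pseudoCompletion hT hc
  have tK := hK.isTight hKc
  have tPK := tP.add tK
  have hge := radiusGE_circumradius (N := N) hT.2.2
  have hge2 := hge.smul
  have hdd := diam_smul_two (diamLE_diam (N := N) hT.2.1) hT.2.2
  have ne2 : ((2 : ℝ) • body T).Nonempty := hT.2.2.smul_set
  set D := diam N (body T)
  set R := circumradius N (body T)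
  have hR : 0 < R := by linarith
  have dP : diam N P = D := tP.diam_eq hT.2.2 le_rfl
  have dK : diam N K = D := tK.diam_eq hT.2.2 le_rfl
  rw [tPK.circumradius_eq hge2 (by linarith), tP.circumradius_eq hge hR,
    tK.circumradius_eq hge hR, tPK.inradius_eq hge2 (by linarith) (by linarith),
    tP.inradius_eq hge hR hRD, tK.inradius_eq hge hR hRD, dP, dK, tPK.diam_eq ne2 hdd,
    tPK.asymmetry_eq hge2 (by linarith) (by linarith), tP.asymmetry_eq hge hR hRD,
    tK.asymmetry_eq hge hR hRD]
  refine ⟨hPb, hKb, by ring, by ring, by ring, rfl, ?_, rfl, tP.not_symm hge h2R hRD,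
    tK.not_symm hge h2R hRD, not_areSimilar_self hN hPK hne hPb.2.1.isClosed hKb.2.1 hPb.2.2 dP dK
      hD, not_areSimilar_euclid hR hRD hge.range_of_body
      ((subset_convexHull ℝ _).trans tP.sub) tP.ball_sub hPK hne hPb.2.1.isClosed hKb.2.1
      tK.diamLE⟩
  rw [← mul_sub, mul_div_mul_left _ _ two_ne_zero]

end PropB

/-! ### The regular simplex in Euclidean space -/

namespace PropB
variable {n : ℕ} {N : Seminorm ℝ (E n)} {X Y K P : Set (E n)} {c : E n} {d R : ℝ}

lemma mem_closedBall_euclid {x c : E n} {r : ℝ} : x ∈ (euclid n).closedBall c r ↔ ‖x - c‖ ≤ r :=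
  Seminorm.mem_closedBall _

/-- Points on a sphere whose centroid is the centre lie in no smaller ball. -/
lemma sq_add_sq_le_of_subset_closedBall {ι : Type*} [Fintype ι] [Nonempty ι] {v : ι → E n}
    {g : E n} (h0 : ∑ i, (v i - g) = 0) (hR : ∀ i, ‖v i - g‖ = R) {c : E n} {ρ : ℝ}
    (h : Set.range v ⊆ (euclid n).closedBall c ρ) : R ^ 2 + ‖g - c‖ ^ 2 ≤ ρ ^ 2 := by
  have h1 : ∀ i, ‖v i - c‖ ^ 2 = R ^ 2 + ‖g - c‖ ^ 2 + 2 * inner ℝ (v i - g) (g - c) := by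
    intro i
    rw [← sub_add_sub_cancel (v i) g c, norm_add_sq_real, hR]
    ring
  have h2 : ∑ i, inner ℝ (v i - g) (g - c) = 0 := by
    rw [← sum_inner, h0, inner_zero_left]
  have h3 : ∑ i : ι, ‖v i - c‖ ^ 2 ≤ ∑ _i : ι, ρ ^ 2 := Finset.sum_le_sum fun i _ =>
    pow_le_pow_left₀ (norm_nonneg _) (mem_closedBall_euclid.1 (h ⟨i, rfl⟩)) 2
  simp only [h1, Finset.sum_add_distrib, ← Finset.mul_sum, h2, mul_zero, add_zero,
    Finset.sum_const, Finset.card_univ, nsmul_eq_mul] at h3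
  have h4 : (0 : ℝ) < Fintype.card ι := by exact_mod_cast Fintype.card_pos
  rw [← mul_add] at h3
  exact le_of_mul_le_mul_left h3 h4

lemma radiusGE_of_centroid {ι : Type*} [Fintype ι] [Nonempty ι] {v : ι → E n}
    {g : E n} (h0 : ∑ i, (v i - g) = 0) (hR : ∀ i, ‖v i - g‖ = R) :
    RadiusGE (euclid n) (Set.range v) R := by
  intro c ρ h
  have h1 := sq_add_sq_le_of_subset_closedBall h0 hR h
  have h2 : 0 ≤ ρ := (norm_nonneg _).trans
    (mem_closedBall_euclid.1 (h ⟨Classical.arbitrary ι, rfl⟩))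
  nlinarith [sq_nonneg ‖g - c‖]

/-- Averaging squared distances leaves no room for `‖g - c‖ ^ 2`; this is the uniqueness of the
Euclidean circumcentre. -/
lemma eq_of_subset_closedBall {ι : Type*} [Fintype ι] [Nonempty ι] {v : ι → E n}
    {g : E n} (h0 : ∑ i, (v i - g) = 0) (hR : ∀ i, ‖v i - g‖ = R)
    (h : Set.range v ⊆ (euclid n).closedBall c R) : c = g := by
  have h1 := sq_add_sq_le_of_subset_closedBall h0 hR h
  have h2 : ‖g - c‖ ^ 2 ≤ 0 := by linarith
  have h3 : ‖g - c‖ = 0 := by nlinarith [norm_nonneg (g - c)]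
  exact (sub_eq_zero.1 (norm_eq_zero.1 h3)).symm

section Regular

variable {T : Affine.Simplex ℝ (E n) n} {ℓ : ℝ}

/-- The centroid of the vertices of a simplex. -/
noncomputable def centre (T : Affine.Simplex ℝ (E n) n) : E n :=
  (1 / (n + 1 : ℝ)) • ∑ i, T.points i

/-- The circumradius of an equilateral simplex with edge length `ℓ`. -/
noncomputable def regularRadius (n : ℕ) (ℓ : ℝ) : ℝ := ℓ * √(n / (2 * (n + 1)))

lemma regularRadius_sq : regularRadius n ℓ ^ 2 = ℓ ^ 2 / 2 * (1 - 1 / (n + 1)) := by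
  rw [regularRadius, mul_pow, Real.sq_sqrt (by positivity)]
  field_simp
  ring

/-- For an equilateral simplex, the coordinates of zero sum are an orthogonal model up to the factor
`ℓ ^ 2 / 2`, so later distance estimates become algebra in the coefficients. -/
lemma inner_sum_points (hℓ : ∀ i j, i ≠ j → dist (T.points i) (T.points j) = ℓ)
    {α β : Fin (n + 1) → ℝ} (hα : ∑ i, α i = 0) (hβ : ∑ i, β i = 0) :
    inner ℝ (∑ i, α i • T.points i) (∑ i, β i • T.points i) = ℓ ^ 2 / 2 * ∑ i, α i * β i := by
  rw [inner_sum_smul_sum_smul_of_sum_eq_zero _ hα _ hβ]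
  have h1 : ∀ i j, α i * β j * (‖T.points i - T.points j‖ * ‖T.points i - T.points j‖) =
      ℓ ^ 2 * (α i * β j) - if i = j then ℓ ^ 2 * (α i * β j) else 0 := by
    intro i j
    by_cases h : i = j
    · simp [h]
    · rw [← dist_eq_norm, hℓ i j h, if_neg h]; ring
  simp only [h1, Finset.sum_sub_distrib, Finset.sum_ite_eq, Finset.mem_univ, if_true,
    ← Finset.mul_sum, hβ, mul_zero, Finset.sum_const_zero]
  ring

lemma norm_sum_points_sq (hℓ : ∀ i j, i ≠ j → dist (T.points i) (T.points j) = ℓ)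
    {α : Fin (n + 1) → ℝ} (hα : ∑ i, α i = 0) :
    ‖∑ i, α i • T.points i‖ ^ 2 = ℓ ^ 2 / 2 * ∑ i, α i ^ 2 := by
  rw [← real_inner_self_eq_norm_sq, inner_sum_points hℓ hα hα]
  simp only [sq]

lemma exists_coord (T : Affine.Simplex ℝ (E n) n) (x : E n) :
    ∃ α : Fin (n + 1) → ℝ, ∑ i, α i = 0 ∧ x - centre T = ∑ i, α i • T.points i := by
  have hx : x ∈ affineSpan ℝ (Set.range T.points) := by
    rw [T.span_eq_top (by simp)]; trivial
  obtain ⟨w, hw, rfl⟩ := eq_affineCombination_of_mem_affineSpan_of_fintype hx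
  refine ⟨fun i => w i - 1 / (n + 1), ?_, ?_⟩
  · rw [Finset.sum_sub_distrib, hw]
    simp only [Finset.sum_const, Finset.card_univ, Fintype.card_fin, nsmul_eq_mul]
    push_cast
    field_simp
    ring
  · rw [Finset.affineCombination_eq_linear_combination _ _ _ hw, centre, Finset.smul_sum,
      ← Finset.sum_sub_distrib]
    simp only [sub_smul]

lemma points_sub_centre (T : Affine.Simplex ℝ (E n) n) (i : Fin (n + 1)) :
    ∑ j, ((if j = i then (1 : ℝ) else 0) - 1 / (n + 1)) = 0 ∧
    T.points i - centre T =
      ∑ j, ((if j = i then (1 : ℝ) else 0) - 1 / (n + 1)) • T.points j := by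
  constructor
  · rw [Finset.sum_sub_distrib]
    simp only [Finset.sum_ite_eq', Finset.mem_univ, if_true, Finset.sum_const, Finset.card_univ,
      Fintype.card_fin, nsmul_eq_mul]
    push_cast
    field_simp
    ring
  · simp only [sub_smul, ite_smul, one_smul, zero_smul, Finset.sum_sub_distrib,
      Finset.sum_ite_eq', Finset.mem_univ, if_true, centre, Finset.smul_sum]

lemma inner_points_sub_centre (hℓ : ∀ i j, i ≠ j → dist (T.points i) (T.points j) = ℓ)
    {α : Fin (n + 1) → ℝ} (hα : ∑ i, α i = 0) (i : Fin (n + 1)) :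
    inner ℝ (∑ i, α i • T.points i) (T.points i - centre T) = ℓ ^ 2 / 2 * α i := by
  rw [(points_sub_centre T i).2, inner_sum_points hℓ hα (points_sub_centre T i).1]
  simp only [mul_sub, mul_ite, mul_one, mul_zero, Finset.sum_sub_distrib, Finset.sum_ite_eq',
    Finset.mem_univ, if_true, ← Finset.sum_mul, hα, zero_mul, sub_zero]

lemma gram (hℓ : ∀ i j, i ≠ j → dist (T.points i) (T.points j) = ℓ) (i j : Fin (n + 1)) :
    inner ℝ (T.points i - centre T) (T.points j - centre T) =
      ℓ ^ 2 / 2 * ((if j = i then (1 : ℝ) else 0) - 1 / (n + 1)) := by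
  rw [(points_sub_centre T i).2, inner_points_sub_centre hℓ (points_sub_centre T i).1]

lemma sum_points_sub_centre (T : Affine.Simplex ℝ (E n) n) :
    ∑ i, (T.points i - centre T) = 0 := by
  rw [Finset.sum_sub_distrib, Finset.sum_const, Finset.card_univ, Fintype.card_fin,
    ← Nat.cast_smul_eq_nsmul ℝ, centre, smul_smul]
  push_cast
  rw [mul_one_div_cancel (by positivity), one_smul, sub_self]

lemma norm_points_sub_centre (hℓ : ∀ i j, i ≠ j → dist (T.points i) (T.points j) = ℓ)
    (hℓ0 : 0 ≤ ℓ) (i : Fin (n + 1)) : ‖T.points i - centre T‖ = regularRadius n ℓ := by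
  rw [← sq_eq_sq₀ (norm_nonneg _) (by unfold regularRadius; positivity), regularRadius_sq,
    ← real_inner_self_eq_norm_sq, gram hℓ, if_pos rfl]

lemma radiusGE_body (hℓ : ∀ i j, i ≠ j → dist (T.points i) (T.points j) = ℓ) (hℓ0 : 0 ≤ ℓ) :
    RadiusGE (euclid n) (body T) (regularRadius n ℓ) := fun c ρ h =>
  radiusGE_of_centroid (sum_points_sub_centre T) (norm_points_sub_centre hℓ hℓ0) c ρ
    ((subset_convexHull ℝ _).trans h)

lemma body_subset_closedBall (hℓ : ∀ i j, i ≠ j → dist (T.points i) (T.points j) = ℓ)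
    (hℓ0 : 0 ≤ ℓ) : body T ⊆ (euclid n).closedBall (centre T) (regularRadius n ℓ) := by
  refine convexHull_min ?_ (Seminorm.convex_closedBall _ _ _)
  rintro _ ⟨i, rfl⟩
  exact mem_closedBall_euclid.2 (norm_points_sub_centre hℓ hℓ0 i).le

lemma regularRadius_pos (hn : 1 ≤ n) (hℓ0 : 0 < ℓ) : 0 < regularRadius n ℓ := by
  have : (0 : ℝ) < n := by exact_mod_cast hn
  unfold regularRadius
  positivity

lemma circumradius_body (hn : 1 ≤ n)
    (hℓ : ∀ i j, i ≠ j → dist (T.points i) (T.points j) = ℓ) (hℓ0 : 0 < ℓ) :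
    circumradius (euclid n) (body T) = regularRadius n ℓ := by
  refine le_antisymm (csInf_le ⟨0, fun ρ h => h.1.le⟩
    ⟨regularRadius_pos hn hℓ0, _, body_subset_closedBall hℓ hℓ0.le⟩) ?_
  refine le_csInf ⟨_, regularRadius_pos hn hℓ0, _, body_subset_closedBall hℓ hℓ0.le⟩ ?_
  rintro ρ ⟨-, c', h⟩
  exact radiusGE_body hℓ hℓ0.le c' ρ h

lemma diam_body (hn : 1 ≤ n)
    (hℓ : ∀ i j, i ≠ j → dist (T.points i) (T.points j) = ℓ) (hℓ0 : 0 < ℓ) :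
    diam (euclid n) (body T) = ℓ := by
  have h1 : DiamLE (euclid n) (body T) ℓ := by
    refine DiamLE.convexHull ?_
    rintro _ ⟨i, rfl⟩ _ ⟨j, rfl⟩
    by_cases h : i = j
    · simpa [h] using hℓ0.le
    · exact (dist_eq_norm (T.points i) (T.points j) ▸ hℓ i j h).le
  refine le_antisymm (h1.diam_le ⟨_, points_mem_body T 0⟩) ?_
  have h01 : (0 : Fin (n + 1)) ≠ Fin.last n := by
    intro h
    have := congrArg Fin.val h
    simp only [Fin.val_zero, Fin.val_last] at this
    omega
  have h2 := h1.le_diam (points_mem_body T 0) (points_mem_body T (Fin.last n))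
  rwa [coe_normSeminorm, ← dist_eq_norm, hℓ _ _ h01] at h2

lemma eq_centre_of_isCircumcenter (hn : 1 ≤ n)
    (hℓ : ∀ i j, i ≠ j → dist (T.points i) (T.points j) = ℓ) (hℓ0 : 0 < ℓ)
    (hc : IsCircumcenter (euclid n) (body T) c) : c = centre T := by
  refine eq_of_subset_closedBall (sum_points_sub_centre T) (norm_points_sub_centre hℓ hℓ0.le)
    ((subset_convexHull ℝ _).trans ?_)
  have := hc
  rwa [IsCircumcenter, circumradius_body hn hℓ hℓ0] at this

lemma isCircumcenter_centre (hn : 1 ≤ n)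
    (hℓ : ∀ i j, i ≠ j → dist (T.points i) (T.points j) = ℓ) (hℓ0 : 0 < ℓ) :
    IsCircumcenter (euclid n) (body T) (centre T) := by
  rw [IsCircumcenter, circumradius_body hn hℓ hℓ0]
  exact body_subset_closedBall hℓ hℓ0.le

/-- The balls of radius `ℓ` about the vertices intersect inside the circumball. -/
lemma norm_sub_centre_le (hn : 1 ≤ n)
    (hℓ : ∀ i j, i ≠ j → dist (T.points i) (T.points j) = ℓ) (hℓ0 : 0 < ℓ) {x : E n}
    (hx : ∀ i, ‖x - T.points i‖ ≤ ℓ) : ‖x - centre T‖ ≤ regularRadius n ℓ := by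
  obtain ⟨α, hα, hxα⟩ := exists_coord T x
  have hn0 : (1 : ℝ) ≤ n := by exact_mod_cast hn
  set k : ℝ := 1 / (n + 1) with hk
  have hk0 : 0 < k := by positivity
  have hkn : k * n = 1 - k := by rw [hk]; field_simp; ring
  have hS := norm_sum_points_sq hℓ hα
  set S := ∑ i, α i ^ 2
  -- Expanding `‖x - T.points i‖ ≤ ℓ` in coordinates bounds each `α i` below by the same number
  -- `-m`; zero sum then bounds each above by `n * m`.
  have hlow : ∀ i, -(1 - (1 - k) / 2 - S / 2) ≤ α i := by
    intro i
    have h1 : ‖x - T.points i‖ ^ 2 ≤ ℓ ^ 2 := pow_le_pow_left₀ (norm_nonneg _) (hx i) 2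
    rw [← sub_sub_sub_cancel_right x _ (centre T), norm_sub_sq_real, hxα,
      inner_points_sub_centre hℓ hα, hS, norm_points_sub_centre hℓ hℓ0.le, regularRadius_sq] at h1
    have hl2 : 0 < ℓ ^ 2 := by positivity
    have h2 : ℓ ^ 2 * (S / 2 - α i + (1 - k) / 2) ≤ ℓ ^ 2 * 1 := by linarith
    have h3 := le_of_mul_le_mul_left h2 hl2
    linarith
  set m := 1 - (1 - k) / 2 - S / 2 with hm
  have hup : ∀ i, α i ≤ n * m := by
    intro i
    have h1 : ∑ j ∈ Finset.univ.erase i, (-m) ≤ ∑ j ∈ Finset.univ.erase i, α j :=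
      Finset.sum_le_sum fun j _ => hlow j
    have h2 := Finset.add_sum_erase Finset.univ α (Finset.mem_univ i)
    simp only [Finset.sum_const, Finset.card_erase_of_mem (Finset.mem_univ i), Finset.card_univ,
      Fintype.card_fin, Nat.add_sub_cancel, nsmul_eq_mul] at h1
    linarith
  have hSm : S ≤ n * (n + 1) * m ^ 2 := by
    -- This is `(α i + m) * (n * m - α i) ≥ 0`. Summing removes the linear term, and `S > 1 - k`
    -- would give `m < k`, hence `S ≤ n (n + 1) k ^ 2 = 1 - k`.
    have h1 : ∀ i, α i ^ 2 ≤ (n - 1) * m * α i + n * m ^ 2 := fun i => by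
      nlinarith [hlow i, hup i]
    have h2 : S ≤ ∑ i, ((n - 1) * m * α i + n * m ^ 2) := Finset.sum_le_sum fun i _ => h1 i
    rw [Finset.sum_add_distrib, ← Finset.mul_sum, hα] at h2
    simp only [Finset.sum_const, Finset.card_univ, Fintype.card_fin, nsmul_eq_mul] at h2
    push_cast at h2
    linarith
  have hS2 : S ≤ 1 - k := by
    by_contra hlt
    rw [not_le] at hlt
    have hm1 : m < k := by linarith
    have hm0 : 0 ≤ m := by
      have := (hlow 0).trans (hup 0)
      nlinarith
    have hn1 : (n + 1 : ℝ) * k = 1 := by rw [hk]; field_simp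
    have hm2 : m ^ 2 ≤ k ^ 2 := pow_le_pow_left₀ hm0 hm1.le 2
    have h3 : (n : ℝ) * (n + 1) * m ^ 2 ≤ n * (n + 1) * k ^ 2 := by gcongr
    have h4 : (n : ℝ) * (n + 1) * k ^ 2 = 1 - k := by
      calc (n : ℝ) * (n + 1) * k ^ 2 = k * n * ((n + 1) * k) := by ring
        _ = 1 - k := by rw [hn1, hkn, mul_one]
    linarith
  rw [← sq_le_sq₀ (norm_nonneg _) (regularRadius_pos hn hℓ0).le, hxα, hS, regularRadius_sq]
  gcongr

/-- A set of diameter at most `d` maximal in Euclidean space is strictly convex. -/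
lemma IsDiamMaximal.closedBall_midpoint_subset (hK : IsDiamMaximal (euclid n) d K) (hd : 0 < d)
    {a b : E n} (ha : a ∈ K) (hb : b ∈ K) (hab : a ≠ b) :
    ∃ ε > 0, ∀ x, ‖x - (2⁻¹ : ℝ) • (a + b)‖ ≤ ε → x ∈ K := by
  have hδ : 0 < ‖a - b‖ := norm_pos_iff.2 (sub_ne_zero.2 hab)
  -- By the parallelogram law the midpoint is within `√(d ^ 2 - ‖a - b‖ ^ 2 / 4)` of every point of
  -- `K`; the slack up to `d` is the radius gained.
  refine ⟨d - √(d ^ 2 - ‖a - b‖ ^ 2 / 4), ?_, fun x hx => hK.2.2 x fun y hy => ?_⟩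
  · rw [gt_iff_lt, sub_pos, Real.sqrt_lt' hd]
    nlinarith
  · have h1 : ‖(2⁻¹ : ℝ) • (a + b) - y‖ ≤ √(d ^ 2 - ‖a - b‖ ^ 2 / 4) := by
      refine Real.le_sqrt_of_sq_le ?_
      have h2 := parallelogram_law_with_norm ℝ ((2⁻¹ : ℝ) • (a - y)) ((2⁻¹ : ℝ) • (b - y))
      have h3 : (2⁻¹ : ℝ) • (a - y) + (2⁻¹ : ℝ) • (b - y) = (2⁻¹ : ℝ) • (a + b) - y := by module
      have h4 : (2⁻¹ : ℝ) • (a - y) - (2⁻¹ : ℝ) • (b - y) = (2⁻¹ : ℝ) • (a - b) := by module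
      rw [h3, h4, norm_smul, norm_smul, norm_smul, norm_inv, Real.norm_two] at h2
      have h5 : ‖a - y‖ ≤ d := hK.2.1 a ha y hy
      have h6 : ‖b - y‖ ≤ d := hK.2.1 b hb y hy
      nlinarith [norm_nonneg (a - y), norm_nonneg (b - y)]
    change ‖x - y‖ ≤ d
    rw [← sub_add_sub_cancel x ((2⁻¹ : ℝ) • (a + b)) y]
    linarith [norm_add_le (x - (2⁻¹ : ℝ) • (a + b)) ((2⁻¹ : ℝ) • (a + b) - y)]

lemma le_two_mul_regularRadius (hn : 1 ≤ n) (hℓ0 : 0 < ℓ) : ℓ ≤ 2 * regularRadius n ℓ := by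
  have hn0 : (1 : ℝ) ≤ n := by exact_mod_cast hn
  have hR := regularRadius_pos hn hℓ0
  have h1 := regularRadius_sq (n := n) (ℓ := ℓ)
  have h2 : (1 : ℝ) / (n + 1) ≤ 1 / 2 := by
    gcongr; linarith
  have h3 : 0 < ℓ ^ 2 := by positivity
  nlinarith

lemma lt_two_mul_regularRadius (hn : 2 ≤ n) (hℓ0 : 0 < ℓ) : ℓ < 2 * regularRadius n ℓ := by
  have hn0 : (2 : ℝ) ≤ n := by exact_mod_cast hn
  have hR := regularRadius_pos (by omega : 1 ≤ n) hℓ0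
  have h1 := regularRadius_sq (n := n) (ℓ := ℓ)
  have h2 : (1 : ℝ) / (n + 1) ≤ 1 / 3 := by
    gcongr; linarith
  have h3 : 0 < ℓ ^ 2 := by positivity
  nlinarith

/-- It says that the inner radius `ℓ - R` is at least `R / n`, the inradius of the simplex. -/
lemma regularRadius_mul_le (hn : 1 ≤ n) (hℓ0 : 0 < ℓ) :
    regularRadius n ℓ * (n + 1) ≤ ℓ * n := by
  have hn0 : (1 : ℝ) ≤ n := by exact_mod_cast hn
  have hR := regularRadius_pos hn hℓ0
  have h1 := regularRadius_sq (n := n) (ℓ := ℓ)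
  rw [← sq_le_sq₀ (by positivity) (by positivity), mul_pow, h1]
  have h2 : ℓ ^ 2 / 2 * (1 - 1 / (n + 1)) * (n + 1 : ℝ) ^ 2 = ℓ ^ 2 / 2 * (n * (n + 1)) := by
    field_simp; ring
  rw [h2]
  have h3 : 0 < ℓ ^ 2 := by positivity
  nlinarith [mul_nonneg h3.le (sub_nonneg.2 hn0)]

/-- A supporting hyperplane of the pseudo completion through a vertex touching the inball. -/
lemma exists_support_direction (hn : 2 ≤ n)
    (hℓ : ∀ i j, i ≠ j → dist (T.points i) (T.points j) = ℓ) (hℓ0 : 0 < ℓ) :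
    ∃ u : E n, u ≠ 0 ∧
      inner ℝ (T.points 0 - centre T) u = (ℓ - regularRadius n ℓ) * ‖u‖ ∧
      ∀ i, inner ℝ (T.points i - centre T) u ≤ inner ℝ (T.points 0 - centre T) u := by
  have hn0 : (2 : ℝ) ≤ n := by exact_mod_cast hn
  have h10 : (1 : Fin (n + 1)) ≠ 0 := by
    intro h
    have := congrArg Fin.val h
    rw [Fin.val_one', Nat.mod_eq_of_lt (by omega)] at this
    simp at this
  have h1 : (1 : ℕ) ≤ n := by omega
  have hR := regularRadius_pos h1 hℓ0
  have hR2 := regularRadius_sq (n := n) (ℓ := ℓ)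
  have hnorm := norm_points_sub_centre hℓ hℓ0.le
  have hl2 : 0 < ℓ ^ 2 := by positivity
  have hle := le_two_mul_regularRadius h1 hℓ0
  have hge := regularRadius_mul_le h1 hℓ0
  set R := regularRadius n ℓ
  set k : ℝ := 1 / (n + 1) with hk
  have hk0 : 0 < k := by positivity
  have hk1 : k * (n + 1) = 1 := by rw [hk]; field_simp
  set w : Fin (n + 1) → E n := fun i => T.points i - centre T with hw
  have hg : ∀ i j, inner ℝ (w i) (w j) = ℓ ^ 2 / 2 * ((if j = i then (1 : ℝ) else 0) - k) :=
    gram hℓ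
  -- Turning from `w 0` towards `-w 1` keeps vertex `0` extremal. The support value there falls from
  -- `R ^ 2 ≥ (ℓ - R) R` to `R ^ 2 / n ≤ (ℓ - R) R`, so some intermediate hyperplane is tangent to
  -- the inner ball.
  let u : ℝ → E n := fun s => (1 - s) • w 0 - s • w 1
  have hu : ∀ i s, inner ℝ (w i) (u s) = ℓ ^ 2 / 2 *
      ((1 - s) * ((if 0 = i then (1 : ℝ) else 0) - k) -
        s * ((if 1 = i then (1 : ℝ) else 0) - k)) := by
    intro i s
    simp only [u, inner_sub_right, real_inner_smul_right, hg]
    ring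
  have hcont : ContinuousOn (fun s => inner ℝ (w 0) (u s) - (ℓ - R) * ‖u s‖) (Set.Icc 0 1) := by
    simp only [u]
    fun_prop
  obtain ⟨s, ⟨hs0, hs1⟩, hs⟩ := intermediate_value_Icc' zero_le_one hcont (show (0 : ℝ) ∈ _ by
    constructor
    · rw [hu]
      have : ‖u 1‖ = R := by simp only [u, sub_self, zero_smul, zero_sub, norm_neg, one_smul]
                             exact hnorm 1
      rw [this, if_pos rfl, if_neg h10]
      have e1 : R ^ 2 = ℓ ^ 2 / 2 * (k * n) := by rw [hR2]; congr 1; linarith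
      have e2 : ℓ ^ 2 / 2 * ((1 - 1) * (1 - k) - 1 * (0 - k)) = ℓ ^ 2 / 2 * k := by ring
      rw [e2]
      have e3 : R * R ≤ n * ((ℓ - R) * R) := by nlinarith
      have e4 : n * (ℓ ^ 2 / 2 * k) ≤ n * ((ℓ - R) * R) := by nlinarith
      have e5 := le_of_mul_le_mul_left e4 (by linarith)
      linarith
    · rw [hu]
      have : ‖u 0‖ = R := by simp only [u, zero_smul, sub_zero, one_smul]
                             exact hnorm 0
      rw [this, if_pos rfl]
      have e2 : ℓ ^ 2 / 2 * ((1 - 0) * (1 - k) - 0 * ((if (1 : Fin (n + 1)) = 0 then (1 : ℝ) else 0)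
        - k)) = R ^ 2 := by rw [hR2]; ring
      rw [e2]
      nlinarith)
  have hs' : inner ℝ (w 0) (u s) = (ℓ - R) * ‖u s‖ := sub_eq_zero.1 hs
  refine ⟨u s, ?_, hs', fun i => ?_⟩
  · intro h0
    have h2 := hu 0 s
    rw [h0, inner_zero_right, if_pos rfl, if_neg h10] at h2
    have h3 : 0 < (1 - s) * (1 - k) - s * (0 - k) := by nlinarith
    have h4 := mul_pos (half_pos hl2) h3
    linarith
  · change inner ℝ (w i) (u s) ≤ inner ℝ (w 0) (u s)
    rw [hu, hu, if_pos rfl, if_neg h10]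
    refine mul_le_mul_of_nonneg_left ?_ (by positivity)
    have a1 : (if 0 = i then (1 : ℝ) else 0) ≤ 1 := by split_ifs <;> norm_num
    have a2 : (0 : ℝ) ≤ (if 1 = i then (1 : ℝ) else 0) := by split_ifs <;> norm_num
    nlinarith [mul_le_mul_of_nonneg_left a1 (sub_nonneg.2 hs1), mul_nonneg hs0 a2]

/-- A supporting hyperplane contains both a vertex and the point `b` where it touches the inner
ball. Completeness would put the midpoint of these two boundary points in the interior. -/
lemma not_isCompleteBody_pseudoCompletion (hn : 2 ≤ n)
    (hℓ : ∀ i j, i ≠ j → dist (T.points i) (T.points j) = ℓ) (hℓ0 : 0 < ℓ)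
    (hc : IsCircumcenter (euclid n) (body T) c) :
    ¬ IsCompleteBody (euclid n) (pseudoCompletion (euclid n) (body T) c) := by
  intro hcomp
  have h1 : 1 ≤ n := by omega
  have htight := isTight_pseudoCompletion (isConvexBody_body T) hc
  have hmax := isCompleteBody_iff.1 hcomp
  rw [htight.diam_eq ⟨_, points_mem_body T 0⟩ le_rfl] at hmax
  obtain rfl := eq_centre_of_isCircumcenter h1 hℓ hℓ0 hc
  rw [circumradius_body h1 hℓ hℓ0, diam_body h1 hℓ hℓ0] at htight
  rw [diam_body h1 hℓ hℓ0] at hmax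
  obtain ⟨u, hu0, hu, hui⟩ := exists_support_direction hn hℓ hℓ0
  have hRl := circumradius_body_lt_diam (T := T) euclid_definite h1
  rw [circumradius_body h1 hℓ hℓ0, diam_body h1 hℓ hℓ0] at hRl
  have hlt := lt_two_mul_regularRadius hn hℓ0
  have hhalf : Convex ℝ {z | inner ℝ (z - centre T) u ≤ (ℓ - regularRadius n ℓ) * ‖u‖} := by
    intro x hx y hy a b ha hb hab
    have : a • x + b • y - centre T = a • (x - centre T) + b • (y - centre T) := by
      have h : centre T = (a + b) • centre T := by rw [hab, one_smul]
      nth_rewrite 1 [h]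
      module
    simp only [Set.mem_ofPred_eq] at hx hy ⊢
    rw [this, inner_add_left, real_inner_smul_left, real_inner_smul_left]
    calc _ ≤ a * ((ℓ - regularRadius n ℓ) * ‖u‖) + b * ((ℓ - regularRadius n ℓ) * ‖u‖) := by
          gcongr
      _ = _ := by rw [← add_mul, hab, one_mul]
  have hsub : pseudoCompletion (euclid n) (body T) (centre T) ⊆
      {z | inner ℝ (z - centre T) u ≤ (ℓ - regularRadius n ℓ) * ‖u‖} := by
    refine convexHull_min (Set.union_subset (convexHull_min ?_ hhalf) ?_) hhalf
    · rintro _ ⟨i, rfl⟩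
      exact hu ▸ hui i
    · intro z hz
      rw [circumradius_body h1 hℓ hℓ0, diam_body h1 hℓ hℓ0] at hz
      have hz' := mem_closedBall_euclid.1 hz
      exact (real_inner_le_norm _ _).trans (by gcongr)
  have hu1 : 0 < ‖u‖ := norm_pos_iff.2 hu0
  set r := ℓ - regularRadius n ℓ with hr
  have hr0 : 0 < r := by linarith
  set b : E n := centre T + (r / ‖u‖) • u with hb
  have hbnorm : ‖b - centre T‖ = r := by
    rw [hb, add_sub_cancel_left, norm_smul, Real.norm_of_nonneg (by positivity),
      div_mul_cancel₀ _ hu1.ne']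
  have hab : T.points 0 ≠ b := by
    intro h
    have := norm_points_sub_centre hℓ hℓ0.le 0
    rw [h, hbnorm] at this
    linarith
  obtain ⟨ε, hε, hball⟩ := hmax.closedBall_midpoint_subset hℓ0 (htight.sub (points_mem_body T 0))
    (htight.ball_sub (mem_closedBall_euclid.2 hbnorm.le)) hab
  have h2 := hsub (hball ((2⁻¹ : ℝ) • (T.points 0 + b) + (ε / ‖u‖) • u) (by
    rw [add_sub_cancel_left, norm_smul, Real.norm_of_nonneg (by positivity),
      div_mul_cancel₀ _ hu1.ne']))
  have h3 : (2⁻¹ : ℝ) • (T.points 0 + b) + (ε / ‖u‖) • u - centre T =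
      (2⁻¹ : ℝ) • (T.points 0 - centre T) + (2⁻¹ * (r / ‖u‖) + ε / ‖u‖) • u := by
    rw [hb]; module
  simp only [Set.mem_ofPred_eq] at h2
  rw [h3, inner_add_left, real_inner_smul_left, real_inner_smul_left, hu,
    real_inner_self_eq_norm_sq] at h2
  have h4 : (2⁻¹ * (r / ‖u‖) + ε / ‖u‖) * ‖u‖ ^ 2 = (2⁻¹ * r + ε) * ‖u‖ := by
    field_simp
  rw [h4] at h2
  nlinarith

lemma completion_subset_circumball (hn : 1 ≤ n)
    (hℓ : ∀ i j, i ≠ j → dist (T.points i) (T.points j) = ℓ) (hℓ0 : 0 < ℓ)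
    (hK : IsCompletion (euclid n) (body T) K) :
    K ⊆ (euclid n).closedBall (centre T) (regularRadius n ℓ) := by
  intro x hx
  refine mem_closedBall_euclid.2 (norm_sub_centre_le hn hℓ hℓ0 fun i => ?_)
  have := hK.isDiamMaximal.2.1 x hx _ (hK.1 (points_mem_body T i))
  rwa [diam_body hn hℓ hℓ0] at this

end Regular

end PropB

/-! ### Constant width, and non-similar inscribed bodies -/

namespace PropB
variable {n : ℕ} {X Y K P A B : Set (E n)} {g : E n} {d R : ℝ}

/-- Translates of supporting points of a maximal set of diameter `d` by `d` along the normal belong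
to the set. -/
lemma IsDiamMaximal.exists_sub_mem (hK : IsDiamMaximal (euclid n) d K) (hd : 0 < d) {u : E n}
    (hu : ‖u‖ = 1) : ∃ x ∈ K, x - d • u ∈ K := by
  obtain ⟨x, hx, hmax⟩ := hK.1.2.1.exists_isMaxOn hK.1.2.2
    (f := fun z => inner ℝ z u) (by fun_prop)
  refine ⟨x, hx, hK.2.2 _ fun y hy => ?_⟩
  change ‖x - d • u - y‖ ≤ d
  by_contra hlt
  rw [not_le] at hlt
  set e := ‖x - y‖ ^ 2 with he
  set κ := inner ℝ (x - y) u with hκ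
  have hκ0 : 0 ≤ κ := by
    have h1 : inner ℝ y u ≤ inner ℝ x u := hmax hy
    rw [hκ, inner_sub_left]; linarith
  have h2 : 2 * d * κ < e := by
    have h3 : d ^ 2 < ‖x - d • u - y‖ ^ 2 := pow_lt_pow_left₀ hlt hd.le two_ne_zero
    rw [sub_right_comm, norm_sub_sq_real, real_inner_smul_right, norm_smul, hu,
      Real.norm_of_nonneg hd.le] at h3
    nlinarith
  -- Assuming `x - d u` is farther than `d` from `y`, the chord from `x` to `y` can be tilted
  -- upwards at a rate `κ'` slightly above its descent `κ`. The point at parameter `t` then lies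
  -- higher than `x` in direction `u`.
  obtain ⟨κ', h3, h4⟩ : ∃ κ', κ < κ' ∧ 2 * d * κ' < e := by
    refine ⟨(κ + e / (2 * d)) / 2, ?_, ?_⟩
    · have : κ < e / (2 * d) := by rw [lt_div_iff₀ (by positivity)]; linarith
      linarith
    · have : 2 * d * ((κ + e / (2 * d)) / 2) = (2 * d * κ + e) / 2 := by field_simp
      rw [this]; linarith
  have hκ' : 0 < κ' := hκ0.trans_lt h3
  have he0 : 0 < e := lt_trans (by positivity) h4
  set t := (e - 2 * d * κ') / (e + κ' ^ 2) with ht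
  have ht0 : 0 < t := div_pos (by linarith) (by positivity)
  have ht1 : t ≤ 1 := by
    rw [ht, div_le_one (by positivity)]
    nlinarith [mul_pos hd hκ', sq_nonneg κ']
  have htt : t * (e + κ' ^ 2) = e - 2 * d * κ' := div_mul_cancel₀ _ (by positivity)
  -- The gain `t (1 - t) e` from convexity of the squared distance pays for the tilt `2 d κ' t + (κ'
  -- t) ^ 2`; `t` is chosen so that they are equal.
  have hz : x + t • (y - x) + (κ' * t) • u ∈ K := by
    refine hK.2.2 _ fun p hp => ?_
    change ‖x + t • (y - x) + (κ' * t) • u - p‖ ≤ d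
    have ha : ‖x - p‖ ≤ d := hK.2.1 x hx p hp
    have hb : ‖y - p‖ ≤ d := hK.2.1 y hy p hp
    have h5 : x + t • (y - x) + (κ' * t) • u - p =
        ((1 - t) • (x - p) + t • (y - p)) + (κ' * t) • u := by module
    have h6 : ‖(1 - t) • (x - p) + t • (y - p)‖ ^ 2 =
        (1 - t) * ‖x - p‖ ^ 2 + t * ‖y - p‖ ^ 2 - t * (1 - t) * e := by
      rw [he, ← sub_sub_sub_cancel_right x y p]
      simp only [← real_inner_self_eq_norm_sq, inner_add_left, inner_add_right, inner_sub_left,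
        inner_sub_right, real_inner_smul_right, real_inner_comm]
      ring
    have h7 : inner ℝ ((1 - t) • (x - p) + t • (y - p)) u ≤ d := by
      refine (real_inner_le_norm _ _).trans ?_
      rw [hu, mul_one]
      refine (norm_add_le _ _).trans ?_
      rw [norm_smul, norm_smul, Real.norm_of_nonneg ht0.le,
        Real.norm_of_nonneg (sub_nonneg.2 ht1)]
      nlinarith
    rw [h5, ← sq_le_sq₀ (norm_nonneg _) hd.le, norm_add_sq_real, h6, real_inner_smul_right,
      norm_smul, hu, Real.norm_of_nonneg (by positivity), mul_one]
    have h8 : ‖x - p‖ ^ 2 ≤ d ^ 2 := pow_le_pow_left₀ (norm_nonneg _) ha 2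
    have h9 : ‖y - p‖ ^ 2 ≤ d ^ 2 := pow_le_pow_left₀ (norm_nonneg _) hb 2
    have h10 : (1 - t) * ‖x - p‖ ^ 2 + t * ‖y - p‖ ^ 2 ≤ d ^ 2 := by nlinarith
    have h11 : κ' * t * inner ℝ ((1 - t) • (x - p) + t • (y - p)) u ≤ κ' * t * d := by gcongr
    have h12 : t * (t * (e + κ' ^ 2)) = t * (e - 2 * d * κ') := by rw [htt]
    nlinarith
  have h13 : inner ℝ (x + t • (y - x) + (κ' * t) • u) u ≤ inner ℝ x u := hmax hz
  have h14 : inner ℝ (y - x) u = -κ := by rw [hκ, ← inner_neg_left, neg_sub]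
  rw [inner_add_left, inner_add_left, real_inner_smul_left, real_inner_smul_left, h14,
    real_inner_self_eq_norm_sq, hu] at h13
  nlinarith

/-- Maximal sets of diameter `d` in Euclidean space have constant width. -/
lemma IsDiamMaximal.isConstantWidth (hK : IsDiamMaximal (euclid n) d K) (hd : 0 < d) :
    IsConstantWidth (euclid n) K := by
  have key : ∀ u : E n, u ≠ 0 → dirWidth (euclid n) K u = d := by
    intro u hu
    have hu0 : 0 < ‖u‖ := norm_pos_iff.2 hu
    have hu1 : ‖‖u‖⁻¹ • u‖ = 1 := by
      rw [norm_smul, norm_inv, norm_norm, inv_mul_cancel₀ hu0.ne']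
    have hin : inner ℝ (‖u‖⁻¹ • u) u = ‖u‖ := by
      rw [real_inner_smul_left, real_inner_self_eq_norm_sq, sq, inv_mul_cancel_left₀ hu0.ne']
    obtain ⟨x, hx, hxd⟩ := hK.exists_sub_mem hd hu1
    have h1 : supportFn (K - K) u = d * ‖u‖ := by
      refine IsGreatest.csSup_eq ⟨⟨x - (x - d • ‖u‖⁻¹ • u), Set.sub_mem_sub hx hxd, ?_⟩, ?_⟩
      · simp only [sub_sub_cancel]
        rw [real_inner_smul_left, hin]
      · rintro _ ⟨_, ⟨a, ha, b, hb, rfl⟩, rfl⟩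
        refine (real_inner_le_norm _ _).trans ?_
        gcongr
        exact hK.2.1 a ha b hb
    have h2 : supportFn ((euclid n).closedBall 0 1) u = ‖u‖ := by
      refine IsGreatest.csSup_eq ⟨⟨‖u‖⁻¹ • u, ?_, hin⟩, ?_⟩
      · rw [mem_closedBall_euclid, sub_zero, hu1]
      · rintro _ ⟨a, ha, rfl⟩
        rw [mem_closedBall_euclid, sub_zero] at ha
        refine (real_inner_le_norm _ _).trans ?_
        nlinarith
    rw [dirWidth, h1, h2, mul_div_cancel_right₀ _ hu0.ne']
  refine ⟨hK.1, fun u hu => ?_⟩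
  have : Nonempty {u : E n // u ≠ 0} := ⟨⟨u, hu⟩⟩
  rw [width, key u hu]
  simp only [fun v : {u : E n // u ≠ 0} => key v v.2, ciInf_const]

lemma exists_separating (hK : Convex ℝ K) (hKc : IsClosed K) (hne : K.Nonempty) {x : E n}
    (hx : x ∉ K) : ∃ (u : E n) (s : ℝ), ‖u‖ = 1 ∧ (∀ y ∈ K, inner ℝ y u ≤ s) ∧
      s < inner ℝ x u := by
  obtain ⟨f, s, hs, hfx⟩ := geometric_hahn_banach_closed_point hK hKc hx
  set w := (InnerProductSpace.toDual ℝ (E n)).symm f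
  have hw : ∀ y, inner ℝ y w = f y := fun y => by
    rw [real_inner_comm]; exact InnerProductSpace.toDual_symm_apply
  have hw0 : 0 < ‖w‖ := by
    refine norm_pos_iff.2 fun h => ?_
    obtain ⟨y, hy⟩ := hne
    have h1 := hs y hy
    rw [← hw, h, inner_zero_right] at h1 hfx
    linarith
  refine ⟨‖w‖⁻¹ • w, ‖w‖⁻¹ * s, ?_, fun y hy => ?_, ?_⟩
  · rw [norm_smul, norm_inv, norm_norm, inv_mul_cancel₀ hw0.ne']
  · rw [real_inner_smul_right, hw]
    gcongr
    exact (hs y hy).le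
  · rw [real_inner_smul_right, hw]
    gcongr

/-- A convex body of diameter at most `d` whose width is at least `d` in all directions is
maximal. -/
lemma isDiamMaximal_of_exists_sub_mem (hK : IsConvexBody K) (hdK : DiamLE (euclid n) K d)
    (h : ∀ u : E n, ‖u‖ = 1 → ∃ x ∈ K, x - d • u ∈ K) : IsDiamMaximal (euclid n) d K := by
  refine ⟨hK, hdK, fun x hx => ?_⟩
  by_contra hxK
  obtain ⟨u, s, hu, hus, hsx⟩ := exists_separating hK.1 hK.2.1.isClosed hK.2.2 hxK
  obtain ⟨z, hz, hzd⟩ := h u hu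
  have h1 : ‖x - (z - d • u)‖ ≤ d := hx _ hzd
  have h2 := real_inner_le_norm (x - (z - d • u)) u
  rw [hu, mul_one, inner_sub_left, inner_sub_left, real_inner_smul_left,
    real_inner_self_eq_norm_sq, hu] at h2
  have := hus z hz
  linarith

/-- Constant width passes to averages, and a body of constant width `d` is maximal; this turns
averaging into an operation on maximal bodies. -/
lemma IsDiamMaximal.average (hA : IsDiamMaximal (euclid n) d A) (hB : IsDiamMaximal (euclid n) d B)
    (hd : 0 < d) : IsDiamMaximal (euclid n) d ((2⁻¹ : ℝ) • (A + B)) := by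
  refine isDiamMaximal_of_exists_sub_mem ⟨(hA.1.1.add hB.1.1).smul _,
    (hA.1.2.1.add hB.1.2.1).smul _, (hA.1.2.2.add hB.1.2.2).smul_set⟩ ?_ fun u hu => ?_
  · rintro _ ⟨_, ⟨a, ha, b, hb, rfl⟩, rfl⟩ _ ⟨_, ⟨a', ha', b', hb', rfl⟩, rfl⟩
    have h1 : ‖a - a'‖ ≤ d := hA.2.1 a ha a' ha'
    have h2 : ‖b - b'‖ ≤ d := hB.2.1 b hb b' hb'
    change ‖(2⁻¹ : ℝ) • (a + b) - (2⁻¹ : ℝ) • (a' + b')‖ ≤ d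
    rw [← smul_sub, add_sub_add_comm, norm_smul, Real.norm_of_nonneg (by norm_num)]
    linarith [norm_add_le (a - a') (b - b')]
  · obtain ⟨a, ha, had⟩ := hA.exists_sub_mem hd hu
    obtain ⟨b, hb, hbd⟩ := hB.exists_sub_mem hd hu
    refine ⟨_, Set.smul_mem_smul_set (Set.add_mem_add ha hb), ?_⟩
    have : (2⁻¹ : ℝ) • (a + b) - d • u = (2⁻¹ : ℝ) • ((a - d • u) + (b - d • u)) := by module
    rw [this]
    exact Set.smul_mem_smul_set (Set.add_mem_add had hbd)

lemma IsDiamMaximal.eq_of_subset {N : Seminorm ℝ (E n)} (hA : IsDiamMaximal N d A)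
    (hB : DiamLE N B d) (h : A ⊆ B) : A = B :=
  h.antisymm fun x hx => hA.2.2 x fun y hy => hB x hx y (h hy)

/-- The support function with respect to the origin `g`. -/
noncomputable def supportFrom (g : E n) (K : Set (E n)) (u : E n) : ℝ :=
  sSup ((fun x => inner ℝ (x - g) u) '' K)


lemma le_supportFrom (hK : K ⊆ (euclid n).closedBall g R) {x : E n} (hx : x ∈ K) (u : E n) :
    inner ℝ (x - g) u ≤ supportFrom g K u := by
  refine le_csSup ⟨R * ‖u‖, ?_⟩ ⟨x, hx, rfl⟩
  rintro _ ⟨y, hy, rfl⟩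
  exact (real_inner_le_norm _ _).trans (by gcongr; exact mem_closedBall_euclid.1 (hK hy))

lemma supportFrom_le (hne : K.Nonempty) {u : E n} {s : ℝ}
    (h : ∀ x ∈ K, inner ℝ (x - g) u ≤ s) : supportFrom g K u ≤ s :=
  csSup_le (hne.image _) (by rintro _ ⟨x, hx, rfl⟩; exact h x hx)

lemma continuous_supportFrom (hK : K ⊆ (euclid n).closedBall g R) (hne : K.Nonempty) :
    Continuous (supportFrom g K) := by
  have hR : 0 ≤ R := by
    obtain ⟨x, hx⟩ := hne
    exact (norm_nonneg _).trans (mem_closedBall_euclid.1 (hK hx))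
  refine (LipschitzWith.of_le_add_mul (K := ⟨R, hR⟩) fun u v => ?_).continuous
  refine supportFrom_le hne fun x hx => ?_
  have h1 := le_supportFrom hK hx v
  have h2 := real_inner_le_norm (x - g) (u - v)
  have h3 : ‖x - g‖ * ‖u - v‖ ≤ R * ‖u - v‖ := by
    gcongr; exact mem_closedBall_euclid.1 (hK hx)
  rw [inner_sub_right] at h2
  rw [dist_eq_norm]
  change _ ≤ _ + R * ‖u - v‖
  linarith

lemma supportFrom_average (hA : A ⊆ (euclid n).closedBall g R)
    (hB : B ⊆ (euclid n).closedBall g R) (hAB : (2⁻¹ : ℝ) • (A + B) ⊆ (euclid n).closedBall g R)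
    (hA0 : A.Nonempty) (hB0 : B.Nonempty) (u : E n) :
    supportFrom g ((2⁻¹ : ℝ) • (A + B)) u = (supportFrom g A u + supportFrom g B u) / 2 := by
  have key : ∀ a b : E n, inner ℝ ((2⁻¹ : ℝ) • (a + b) - g) u =
      (inner ℝ (a - g) u + inner ℝ (b - g) u) / 2 := by
    intro a b
    rw [inner_sub_left, real_inner_smul_left, inner_add_left, inner_sub_left, inner_sub_left]
    ring
  refine le_antisymm (supportFrom_le (hA0.add hB0).smul_set ?_) ?_
  · rintro _ ⟨_, ⟨a, ha, b, hb, rfl⟩, rfl⟩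
    change inner ℝ ((2⁻¹ : ℝ) • (a + b) - g) u ≤ _
    rw [key]
    linarith [le_supportFrom hA ha u, le_supportFrom hB hb u]
  · have h1 : ∀ a ∈ A, ∀ b ∈ B, (inner ℝ (a - g) u + inner ℝ (b - g) u) / 2 ≤
        supportFrom g ((2⁻¹ : ℝ) • (A + B)) u := fun a ha b hb => by
      rw [← key]
      exact le_supportFrom hAB (Set.smul_mem_smul_set (Set.add_mem_add ha hb)) u
    have h2 : ∀ a ∈ A, supportFrom g B u ≤
        2 * supportFrom g ((2⁻¹ : ℝ) • (A + B)) u - inner ℝ (a - g) u := fun a ha =>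
      supportFrom_le hB0 fun b hb => by linarith [h1 a ha b hb]
    have h3 : supportFrom g A u ≤
        2 * supportFrom g ((2⁻¹ : ℝ) • (A + B)) u - supportFrom g B u :=
      supportFrom_le hA0 fun a ha => by linarith [h2 a ha]
    linarith


open MeasureTheory

/-- A rotation invariant quadratic functional of the support function. -/
noncomputable def supportEnergy (g : E n) (K : Set (E n)) : ℝ :=
  ∫ u : E n, max 0 (1 - ‖u‖) * supportFrom g K u ^ 2

lemma hasCompactSupport_bump_mul (f : E n → ℝ) :
    HasCompactSupport fun u : E n => max 0 (1 - ‖u‖) * f u := by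
  refine HasCompactSupport.intro (isCompact_closedBall (0 : E n) 1) fun u hu => ?_
  rw [mem_closedBall_zero_iff, not_le] at hu
  rw [max_eq_left (by linarith), zero_mul]

lemma supportEnergy_image (U : E n ≃ₗᵢ[ℝ] E n) :
    supportEnergy g ((fun x => g + U (x - g)) '' K) = supportEnergy g K := by
  have h1 : ∀ u, supportFrom g ((fun x => g + U (x - g)) '' K) u =
      supportFrom g K (U.symm u) := by
    intro u
    rw [supportFrom, supportFrom, Set.image_image]
    congr 1
    refine Set.image_congr fun x _ => ?_
    rw [add_sub_cancel_left]
    nth_rewrite 1 [← U.apply_symm_apply u]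
    rw [U.inner_map_map]
  unfold supportEnergy
  simp only [h1]
  have h2 := (U.symm.measurePreserving).integral_comp U.symm.toHomeomorph.measurableEmbedding
    (fun u => max 0 (1 - ‖u‖) * supportFrom g K u ^ 2)
  rw [← h2]
  simp only [LinearIsometryEquiv.norm_map]

/-- Bodies between a set with circumcentre `g` and its circumball. -/
structure IsInscribed {ι : Type*} (v : ι → E n) (g : E n) (d R : ℝ) (K : Set (E n)) : Prop where
  maximal : IsDiamMaximal (euclid n) d K
  sub : Set.range v ⊆ K
  sub_ball : K ⊆ (euclid n).closedBall g R

variable {ι : Type*} {v : ι → E n}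

lemma IsInscribed.average (hA : IsInscribed v g d R A) (hB : IsInscribed v g d R B) (hd : 0 < d) :
    IsInscribed v g d R ((2⁻¹ : ℝ) • (A + B)) := by
  refine ⟨hA.maximal.average hB.maximal hd, fun x hx => ?_, ?_⟩
  · exact ⟨x + x, Set.add_mem_add (hA.sub hx) (hB.sub hx), by
      change (2⁻¹ : ℝ) • (x + x) = x
      module⟩
  · rintro _ ⟨_, ⟨a, ha, b, hb, rfl⟩, rfl⟩
    have h1 := mem_closedBall_euclid.1 (hA.sub_ball ha)
    have h2 := mem_closedBall_euclid.1 (hB.sub_ball hb)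
    change (2⁻¹ : ℝ) • (a + b) ∈ _
    have h3 : (2⁻¹ : ℝ) • (a + b) - g = (2⁻¹ : ℝ) • ((a - g) + (b - g)) := by module
    rw [mem_closedBall_euclid, h3, norm_smul, Real.norm_of_nonneg (by norm_num)]
    linarith [norm_add_le (a - g) (b - g)]

/-- Equal constant width forces ratio one, and uniqueness of the circumcentre forces the isometry to
fix `g`; the energy is invariant under such maps. -/
lemma IsInscribed.supportEnergy_eq [Fintype ι] [Nonempty ι] (hn : 1 ≤ n)
    (hd : 0 < d) (h0 : ∑ i, (v i - g) = 0)
    (hR : ∀ i, ‖v i - g‖ = R) (hA : IsInscribed v g d R A) (hB : IsInscribed v g d R B)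
    (hAB : AreSimilar (euclid n) A B) : supportEnergy g B = supportEnergy g A := by
  obtain ⟨f, ρ, hρ, hf, hfA⟩ := hAB
  have hu : ‖(EuclideanSpace.single (⟨0, hn⟩ : Fin n) (1 : ℝ) : E n)‖ = 1 := by simp
  have hf' : ∀ x y, ‖f x - f y‖ = ρ * ‖x - y‖ := hf
  have hρ1 : ρ = 1 := by
    apply le_antisymm
    · obtain ⟨x, hx, hx'⟩ := hA.maximal.exists_sub_mem hd hu
      have h1 : ‖f x - f _‖ ≤ d :=
        hB.maximal.2.1 _ (hfA ▸ Set.mem_image_of_mem f hx) _ (hfA ▸ Set.mem_image_of_mem f hx')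
      rw [hf', sub_sub_cancel, norm_smul, hu, Real.norm_of_nonneg hd.le] at h1
      nlinarith
    · obtain ⟨x, hx, hx'⟩ := hB.maximal.exists_sub_mem hd hu
      rw [← hfA] at hx hx'
      obtain ⟨a, ha, rfl⟩ := hx
      obtain ⟨b, hb, hab⟩ := hx'
      have h1 : ‖a - b‖ ≤ d := hA.maximal.2.1 a ha b hb
      have h2 := hf' a b
      rw [hab, sub_sub_cancel, norm_smul, hu, Real.norm_of_nonneg hd.le] at h2
      nlinarith
  subst hρ1
  obtain ⟨U, hU⟩ := exists_linear_of_similarity hρ hf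
  let V := U.toLinearIsometryEquiv rfl
  have hV : ∀ x, f x = f 0 + V x := fun x => by rw [hU x, one_smul]; rfl
  have hq : f (V.symm (g - f 0)) = g := by
    rw [hV, V.apply_symm_apply, add_sub_cancel]
  -- The preimage of `g` is within `R` of every `v i`, because their images lie in the ball about
  -- `g`; only `g` has this property.
  have hqg : V.symm (g - f 0) = g := by
    refine eq_of_subset_closedBall h0 hR fun x hx => ?_
    have h1 := mem_closedBall_euclid.1 (hB.sub_ball (hfA ▸ ⟨x, hA.sub hx, rfl⟩ : f x ∈ B))
    rw [mem_closedBall_euclid]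
    nth_rewrite 1 [← hq] at h1
    rwa [hf', one_mul] at h1
  rw [hqg] at hq
  rw [← hfA, ← supportEnergy_image V (g := g) (K := A)]
  congr 1
  refine Set.image_congr fun x _ => ?_
  nth_rewrite 1 [← hq]
  rw [hV x, hV g, map_sub]
  abel

/-- Two different inscribed bodies give rise to two inscribed bodies which are not similar. -/
lemma IsInscribed.exists_not_areSimilar [Fintype ι] [Nonempty ι] (hn : 1 ≤ n)
    (hd : 0 < d) (h0 : ∑ i, (v i - g) = 0)
    (hR : ∀ i, ‖v i - g‖ = R) (hA : IsInscribed v g d R A) (hB : IsInscribed v g d R B)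
    (hAB : A ≠ B) : ∃ K L, IsInscribed v g d R K ∧ IsInscribed v g d R L ∧
      ¬ AreSimilar (euclid n) K L := by
  by_contra! hcon
  have hM := hA.average hB hd
  have e1 := hA.supportEnergy_eq hn hd h0 hR hB (hcon _ _ hA hB)
  have e2 := hA.supportEnergy_eq hn hd h0 hR hM (hcon _ _ hA hM)
  have cA := continuous_supportFrom hA.sub_ball hA.maximal.1.2.2
  have cB := continuous_supportFrom hB.sub_ball hB.maximal.1.2.2
  have cM := continuous_supportFrom hM.sub_ball hM.maximal.1.2.2
  have hint : ∀ f : E n → ℝ, Continuous f →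
      Integrable fun u : E n => max 0 (1 - ‖u‖) * f u := fun f hf =>
    Continuous.integrable_of_hasCompactSupport (by fun_prop) (hasCompactSupport_bump_mul f)
  obtain ⟨x, hxA, hxB⟩ : ∃ x ∈ A, x ∉ B := by
    by_contra! hsub
    exact hAB (hA.maximal.eq_of_subset hB.maximal.2.1 hsub)
  obtain ⟨u, s, hu, hus, hsx⟩ := exists_separating hB.maximal.1.1 hB.maximal.1.2.1.isClosed
    hB.maximal.1.2.2 hxB
  -- The separating direction is halved because the weight vanishes on the unit sphere.
  have hlt : supportFrom g B ((2⁻¹ : ℝ) • u) < supportFrom g A ((2⁻¹ : ℝ) • u) := by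
    refine lt_of_le_of_lt (supportFrom_le hB.maximal.1.2.2 (s := 2⁻¹ * (s - inner ℝ g u))
      fun y hy => ?_) (lt_of_lt_of_le ?_ (le_supportFrom hA.sub_ball hxA _))
    · rw [real_inner_smul_right, inner_sub_left]
      linarith [hus y hy]
    · rw [real_inner_smul_right, inner_sub_left]
      linarith
  have hpos : 0 < ∫ u : E n, max 0 (1 - ‖u‖) * (supportFrom g A u - supportFrom g B u) ^ 2 := by
    refine Continuous.integral_pos_of_hasCompactSupport_nonneg_nonzero (x := (2⁻¹ : ℝ) • u)
      (by fun_prop) (hasCompactSupport_bump_mul _) (fun u => by positivity) ?_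
    refine mul_ne_zero ?_ (pow_ne_zero 2 (sub_ne_zero.2 hlt.ne'))
    rw [norm_smul, hu]
    norm_num
  -- The support function of the average is the average of the support functions, so this is the
  -- parallelogram identity; equal energies would make its integral zero.
  have heq : ∀ u : E n, max 0 (1 - ‖u‖) * (supportFrom g A u - supportFrom g B u) ^ 2 =
      2 * (max 0 (1 - ‖u‖) * supportFrom g A u ^ 2) +
        2 * (max 0 (1 - ‖u‖) * supportFrom g B u ^ 2) -
        4 * (max 0 (1 - ‖u‖) * supportFrom g ((2⁻¹ : ℝ) • (A + B)) u ^ 2) := by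
    intro u
    rw [supportFrom_average hA.sub_ball hB.sub_ball hM.sub_ball hA.maximal.1.2.2
      hB.maximal.1.2.2]
    ring
  simp only [heq] at hpos
  have iA := hint (fun u => supportFrom g A u ^ 2) (cA.pow 2)
  have iB := hint (fun u => supportFrom g B u ^ 2) (cB.pow 2)
  have iM := hint (fun u => supportFrom g ((2⁻¹ : ℝ) • (A + B)) u ^ 2) (cM.pow 2)
  have iAB : Integrable (fun u : E n => 2 * (max 0 (1 - ‖u‖) * supportFrom g A u ^ 2) +
      2 * (max 0 (1 - ‖u‖) * supportFrom g B u ^ 2)) := (iA.const_mul 2).add (iB.const_mul 2)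
  rw [integral_sub iAB (iM.const_mul 4), integral_add (iA.const_mul 2) (iB.const_mul 2),
    integral_const_mul, integral_const_mul, integral_const_mul] at hpos
  change 0 < 2 * supportEnergy g A + 2 * supportEnergy g B - 4 * supportEnergy g _ at hpos
  rw [e1, e2] at hpos
  linarith

/-- If two points can be added to a set but not both, there are inscribed bodies which are not
similar. -/
lemma exists_isInscribed_not_areSimilar [Fintype ι] [Nonempty ι] (hn : 1 ≤ n)
    (hd : 0 < d) (h0 : ∑ i, (v i - g) = 0)
    (hR : ∀ i, ‖v i - g‖ = R) (hRd : R ≤ d) (hdR : d ≤ 2 * R)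
    (hv : DiamLE (euclid n) (Set.range v) d) {x y : E n} (hx : ∀ i, ‖x - v i‖ ≤ d)
    (hy : ∀ i, ‖y - v i‖ ≤ d) (hxg : ‖x - g‖ ≤ R) (hyg : ‖y - g‖ ≤ R) (hxy : d < ‖x - y‖) :
    ∃ K L, IsInscribed v g d R K ∧ IsInscribed v g d R L ∧ ¬ AreSimilar (euclid n) K L := by
  have key : ∀ z : E n, (∀ i, ‖z - v i‖ ≤ d) → ‖z - g‖ ≤ R →
      ∃ K, z ∈ K ∧ IsInscribed v g d R K := by
    intro z hz hzg
    have h1 : DiamLE (euclid n) (insert z (Set.range v)) d := by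
      rintro a (rfl | ha) b (rfl | hb)
      · simpa using hd.le
      · obtain ⟨i, rfl⟩ := hb; exact hz i
      · obtain ⟨i, rfl⟩ := ha; rw [map_sub_rev]; exact hz i
      · exact hv a ha b hb
    have h2 : insert z (Set.range v) ⊆ (euclid n).closedBall g R := by
      rintro a (rfl | ⟨i, rfl⟩)
      · exact mem_closedBall_euclid.2 hzg
      · exact mem_closedBall_euclid.2 (hR i).le
    obtain ⟨K, hK, hKm, hKg⟩ := exists_isDiamMaximal_subset euclid_definite h1
      (Set.insert_nonempty _ _) h2 hRd hdR
    exact ⟨K, hK (Set.mem_insert _ _), hKm, (Set.subset_insert _ _).trans hK, hKg⟩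
  obtain ⟨A, hxA, hA⟩ := key x hx hxg
  obtain ⟨B, hyB, hB⟩ := key y hy hyg
  refine hA.exists_not_areSimilar hn hd h0 hR hB fun h => ?_
  exact hxy.not_ge (hA.maximal.2.1 x hxA y (h ▸ hyB))

end PropB

/-! ### Completions of the regular simplex, and the plane -/

namespace PropB
variable {n : ℕ} {X Y K P A B : Set (E n)} {g : E n} {d R : ℝ}

section Asymmetry

variable {ι : Type*} [Fintype ι] [Nonempty ι] {v : ι → E n}

lemma IsInscribed.asymmetry_eq (hK : IsInscribed v g d R K) (h0 : ∑ i, (v i - g) = 0)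
    (hR : ∀ i, ‖v i - g‖ = R) (hR0 : 0 < R) (hRd : R < d) : asymmetry K = R / (d - R) :=
  (hK.maximal.isTight hK.sub hK.sub_ball).asymmetry_eq (radiusGE_of_centroid h0 hR) hR0 hRd

lemma IsInscribed.asymmetry_add (hA : IsInscribed v g d R A) (hB : IsInscribed v g d R B)
    (h0 : ∑ i, (v i - g) = 0) (hR : ∀ i, ‖v i - g‖ = R) (hR0 : 0 < R) (hRd : R < d) :
    asymmetry (A + B) = R / (d - R) := by
  rw [((hA.maximal.isTight hA.sub hA.sub_ball).add
    (hB.maximal.isTight hB.sub hB.sub_ball)).asymmetry_eq (radiusGE_of_centroid h0 hR).smul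
    (by linarith) (by linarith), ← mul_sub, mul_div_mul_left _ _ two_ne_zero]

lemma IsInscribed.not_symm (hK : IsInscribed v g d R K) (h0 : ∑ i, (v i - g) = 0)
    (hR : ∀ i, ‖v i - g‖ = R) (hdR : d < 2 * R) (hRd : R < d) : ¬ IsCentrallySymmetric K :=
  (hK.maximal.isTight hK.sub hK.sub_ball).not_symm (radiusGE_of_centroid h0 hR) hdR hRd

end Asymmetry

variable {T : Affine.Simplex ℝ (E n) n} {ℓ : ℝ}

lemma isInscribed_iff_isCompletion (hn : 1 ≤ n)
    (hℓ : ∀ i j, i ≠ j → dist (T.points i) (T.points j) = ℓ) (hℓ0 : 0 < ℓ) :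
    IsInscribed T.points (centre T) ℓ (regularRadius n ℓ) K ↔
      IsCompletion (euclid n) (body T) K := by
  constructor
  · intro h
    refine IsDiamMaximal.isCompletion ?_ (convexHull_min h.sub h.maximal.1.1)
      ⟨_, points_mem_body T 0⟩
    rw [diam_body hn hℓ hℓ0]
    exact h.maximal
  · intro h
    refine ⟨?_, (subset_convexHull ℝ _).trans h.1, completion_subset_circumball hn hℓ hℓ0 h⟩
    have := h.isDiamMaximal
    rwa [diam_body hn hℓ hℓ0] at this

lemma regularRadius_lt (hn : 1 ≤ n) (hℓ0 : 0 < ℓ) : regularRadius n ℓ < ℓ := by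
  have hn0 : (1 : ℝ) ≤ n := by exact_mod_cast hn
  nlinarith [regularRadius_mul_le hn hℓ0]

lemma diamLE_range_points (hℓ : ∀ i j, i ≠ j → dist (T.points i) (T.points j) = ℓ)
    (hℓ0 : 0 ≤ ℓ) : DiamLE (euclid n) (Set.range T.points) ℓ := by
  rintro _ ⟨i, rfl⟩ _ ⟨j, rfl⟩
  by_cases h : i = j
  · simpa [h] using hℓ0
  · exact (dist_eq_norm (T.points i) (T.points j) ▸ hℓ i j h).le

lemma norm_sum_sub_sum_sq (hℓ : ∀ i j, i ≠ j → dist (T.points i) (T.points j) = ℓ)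
    {a b : Fin (n + 1) → ℝ} (hab : ∑ i, a i = ∑ i, b i) :
    ‖∑ i, a i • T.points i - ∑ i, b i • T.points i‖ ^ 2 = ℓ ^ 2 / 2 * ∑ i, (a i - b i) ^ 2 := by
  rw [← norm_sum_points_sq hℓ (α := fun i => a i - b i)
    (by rw [Finset.sum_sub_distrib, hab, sub_self]), ← Finset.sum_sub_distrib]
  simp only [sub_smul]

lemma norm_sum_sub_point_sq (hℓ : ∀ i j, i ≠ j → dist (T.points i) (T.points j) = ℓ)
    {a : Fin (n + 1) → ℝ} (ha : ∑ i, a i = 1) (k : Fin (n + 1)) :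
    ‖∑ i, a i • T.points i - T.points k‖ ^ 2 = ℓ ^ 2 / 2 * (∑ i, a i ^ 2 - 2 * a k + 1) := by
  have h1 : T.points k = ∑ i, (Pi.single k (1 : ℝ) : Fin (n + 1) → ℝ) i • T.points i := by
    rw [Finset.sum_eq_single k (fun j _ hj => by simp [Pi.single_eq_of_ne hj]) (by simp)]
    simp
  nth_rewrite 1 [h1]
  rw [norm_sum_sub_sum_sq hℓ (by rw [ha, Finset.sum_pi_single']; simp)]
  congr 1
  have h2 : ∀ i, (a i - (Pi.single k (1 : ℝ) : Fin (n + 1) → ℝ) i) ^ 2 =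
      a i ^ 2 + if i = k then 1 - 2 * a i else 0 := by
    intro i
    by_cases h : i = k
    · subst h; simp; ring
    · simp [h]
  simp only [h2, Finset.sum_add_distrib, Finset.sum_ite_eq', Finset.mem_univ, if_true]
  ring

/-- In dimension at least three a regular simplex has completions which are not similar. -/
lemma exists_completions_not_areSimilar (hn : 3 ≤ n)
    (hℓ : ∀ i j, i ≠ j → dist (T.points i) (T.points j) = ℓ) (hℓ0 : 0 < ℓ) :
    ∃ K L, IsCompletion (euclid n) (body T) K ∧ IsCompletion (euclid n) (body T) L ∧
      ¬ AreSimilar (euclid n) K L := by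
  have h1 : 1 ≤ n := by omega
  suffices h : ∃ K L, IsInscribed T.points (centre T) ℓ (regularRadius n ℓ) K ∧
      IsInscribed T.points (centre T) ℓ (regularRadius n ℓ) L ∧ ¬ AreSimilar (euclid n) K L by
    obtain ⟨K, L, hK, hL, hKL⟩ := h
    exact ⟨K, L, (isInscribed_iff_isCompletion h1 hℓ hℓ0).1 hK,
      (isInscribed_iff_isCompletion h1 hℓ hℓ0).1 hL, hKL⟩
  -- The points lie on the common perpendicular of two opposite edges of a tetrahedral face, each at
  -- distance exactly `ℓ` from one edge's endpoints, as with the arc midpoints of a Reuleaux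
  -- tetrahedron. That condition gives `s ^ 2 = 3 / 2`, and their squared distance `2 (7 / 4 - s) ℓ
  -- ^ 2` exceeds `ℓ ^ 2` since `s < 5 / 4`.
  obtain ⟨s, hs0, hs2⟩ : ∃ s : ℝ, 0 ≤ s ∧ s ^ 2 = 3 / 2 :=
    ⟨√(3 / 2), Real.sqrt_nonneg _, Real.sq_sqrt (by norm_num)⟩
  have hs1 : 1 ≤ s := by nlinarith
  have hs3 : s < 5 / 4 := by nlinarith
  obtain ⟨k, rfl⟩ : ∃ k, n = k + 3 := ⟨n - 3, by omega⟩
  let a : ℝ → ℝ → Fin (k + 3 + 1) → ℝ := fun p q =>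
    Fin.cons p (Fin.cons p (Fin.cons q (Fin.cons q (fun _ : Fin k => 0))))
  have hsum : ∀ p q, ∑ i, a p q i = 2 * p + 2 * q := fun p q => by
    simp only [a, Fin.sum_univ_succ, Fin.cons_zero, Fin.cons_succ, Finset.sum_const_zero]
    ring
  have hsq : ∀ p q, ∑ i, a p q i ^ 2 = 2 * p ^ 2 + 2 * q ^ 2 := fun p q => by
    simp only [a, Fin.sum_univ_succ, Fin.cons_zero, Fin.cons_succ]
    simp
    ring
  have hdiff : ∀ p q, ∑ i, (a p q i - a q p i) ^ 2 = 4 * (p - q) ^ 2 := fun p q => by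
    simp only [a, Fin.sum_univ_succ, Fin.cons_zero, Fin.cons_succ]
    simp
    ring
  have hge : ∀ p q t, t ≤ 0 → t ≤ p → t ≤ q → ∀ i, t ≤ a p q i := by
    intro p q t h0 hp hq
    simp only [a, Fin.forall_fin_succ, Fin.cons_zero, Fin.cons_succ]
    exact ⟨hp, hp, hq, hq, fun _ => h0⟩
  have hnear : ∀ p q, p + q = 1 / 2 → p ^ 2 + q ^ 2 = 1 - s / 2 → (1 - s) / 2 ≤ p →
      (1 - s) / 2 ≤ q → ∀ i, ‖∑ j, a p q j • T.points j - T.points i‖ ≤ ℓ := by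
    intro p q hpq hpq2 hp hq i
    have h2 := norm_sum_sub_point_sq hℓ (a := a p q) (by rw [hsum]; linarith) i
    rw [hsq] at h2
    have h3 := hge p q _ (by linarith) hp hq i
    rw [← sq_le_sq₀ (norm_nonneg _) hℓ0.le, h2]
    have h4 : 0 < ℓ ^ 2 := by positivity
    nlinarith
  have hx := hnear ((1 - s) / 2) (s / 2) (by ring) (by nlinarith) le_rfl (by linarith)
  have hy := hnear (s / 2) ((1 - s) / 2) (by ring) (by nlinarith) (by linarith) le_rfl
  refine exists_isInscribed_not_areSimilar h1 hℓ0 (sum_points_sub_centre T)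
    (norm_points_sub_centre hℓ hℓ0.le) (regularRadius_lt h1 hℓ0).le
    (le_two_mul_regularRadius h1 hℓ0) (diamLE_range_points hℓ hℓ0.le) hx hy
    (norm_sub_centre_le h1 hℓ hℓ0 hx) (norm_sub_centre_le h1 hℓ hℓ0 hy) ?_
  rw [← sq_lt_sq₀ hℓ0.le (norm_nonneg _), norm_sum_sub_sum_sq hℓ (by rw [hsum, hsum]; ring),
    hdiff]
  have h4 : 0 < ℓ ^ 2 := by positivity
  nlinarith

/-- In the plane there are bodies of constant width less asymmetric than the Reuleaux triangle
for which equality holds in the inequality for the asymmetry of a Minkowski sum. -/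
lemma exists_planar_not_areSimilar {T : Affine.Simplex ℝ (E 2) 2}
    (hℓ : ∀ i j, i ≠ j → dist (T.points i) (T.points j) = ℓ) (hℓ0 : 0 < ℓ) :
    ∃ K L, IsConstantWidth (euclid 2) K ∧ IsConstantWidth (euclid 2) L ∧
      asymmetry (K + L) = asymmetry K ∧ asymmetry K = asymmetry L ∧
      (∀ M, IsCompletion (euclid 2) (body T) M → asymmetry K < asymmetry M) ∧
      ¬ IsCentrallySymmetric K ∧ ¬ IsCentrallySymmetric L ∧ ¬ AreSimilar (euclid 2) K L := by
  have h12 : (1 : ℕ) ≤ 2 := by norm_num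
  have hR0 := regularRadius_pos h12 hℓ0
  have hR2 := regularRadius_sq (n := 2) (ℓ := ℓ)
  have hRℓ := regularRadius_lt h12 hℓ0
  have hnorm := norm_points_sub_centre hℓ hℓ0.le
  have hl2 : 0 < ℓ ^ 2 := by positivity
  set ρ := regularRadius 2 ℓ
  -- Any radius slightly above `ℓ / 2` would do: below `ρ` it lowers the asymmetry, and above `ℓ /
  -- 2` it leaves room in the disc for two points more than `ℓ` apart. The triangle is shrunk to
  -- this circumradius.
  set R' := 51 / 100 * ℓ with hR'
  have hR2' : ρ ^ 2 = ℓ ^ 2 / 3 := by rw [hR2]; norm_num; ring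
  have hR'ρ : R' < ρ := by nlinarith
  set μ := R' / ρ with hμ
  have hμ0 : 0 < μ := by positivity
  have hμ1 : μ ≤ 1 := (div_le_one hR0).2 hR'ρ.le
  have hμ2 : μ ^ 2 = 7803 / 10000 := by
    rw [hμ, div_pow, hR2', hR']; field_simp; norm_num
  have hμ3 : μ ≤ 9 / 10 := by nlinarith
  set w : Fin 3 → E 2 := fun i => T.points i - centre T with hw
  have hg : ∀ i j, inner ℝ (w i) (w j) = ℓ ^ 2 / 2 * ((if j = i then (1 : ℝ) else 0) - 1 / 3) := by
    intro i j
    rw [gram hℓ i j]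
    norm_num
  let v : Fin 3 → E 2 := fun i => centre T + μ • w i
  have hvg : ∀ i, v i - centre T = μ • w i := fun i => add_sub_cancel_left _ _
  have h0 : ∑ i, (v i - centre T) = 0 := by
    simp only [hvg, ← Finset.smul_sum]
    rw [sum_points_sub_centre T, smul_zero]
  have hvR : ∀ i, ‖v i - centre T‖ = R' := fun i => by
    rw [hvg, norm_smul, Real.norm_of_nonneg hμ0.le]
    change μ * ‖T.points i - centre T‖ = R'
    rw [hnorm, hμ, div_mul_cancel₀ _ hR0.ne']
  have hvd : DiamLE (euclid 2) (Set.range v) ℓ := by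
    rintro _ ⟨i, rfl⟩ _ ⟨j, rfl⟩
    have h1 : v i - v j = μ • (T.points i - T.points j) := by
      simp only [v, w]; module
    rw [h1, map_smul_eq_mul, Real.norm_of_nonneg hμ0.le]
    have h2 := diamLE_range_points hℓ hℓ0.le _ ⟨i, rfl⟩ _ ⟨j, rfl⟩
    nlinarith [apply_nonneg (euclid 2) (T.points i - T.points j)]
  have hedge : ‖w 1 - w 2‖ = ℓ := by
    simp only [w, sub_sub_sub_cancel_right]
    rw [← dist_eq_norm]
    exact hℓ 1 2 (by decide)
  have hxg : ∀ t : ℝ, |t| = 51 / 100 → ‖centre T + t • (w 1 - w 2) - centre T‖ = R' := by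
    intro t ht
    rw [add_sub_cancel_left, norm_smul, Real.norm_eq_abs, ht, hedge]
  have hxv : ∀ t : ℝ, |t| = 51 / 100 → ∀ i, ‖centre T + t • (w 1 - w 2) - v i‖ ≤ ℓ := by
    intro t ht i
    have h1 : centre T + t • (w 1 - w 2) - v i = t • (w 1 - w 2) - μ • w i := by
      simp only [v]; module
    have h2 : |inner ℝ (w 1 - w 2) (w i)| ≤ ℓ ^ 2 / 2 := by
      rw [inner_sub_left, hg, hg, ← mul_sub, abs_mul, abs_of_pos (half_pos hl2)]
      refine mul_le_of_le_one_right (by positivity) ?_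
      rw [sub_sub_sub_cancel_right, abs_le]
      constructor <;> split_ifs <;> norm_num
    have h3 : ‖t • (w 1 - w 2)‖ = R' := by
      have := hxg t ht
      rwa [add_sub_cancel_left] at this
    have h4 : ‖μ • w i‖ = R' := by rw [← hvg, hvR]
    -- With this bound, the squared distance to each `v i` is at most `(0.5202 + 0.459) ℓ ^ 2 < ℓ ^
    -- 2`.
    have h5 : |inner ℝ (t • (w 1 - w 2)) (μ • w i)| ≤ 51 / 100 * (9 / 10 * (ℓ ^ 2 / 2)) := by
      rw [real_inner_smul_left, real_inner_smul_right, abs_mul, abs_mul, ht, abs_of_pos hμ0]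
      gcongr
    rw [h1, ← sq_le_sq₀ (norm_nonneg _) hℓ0.le, norm_sub_sq_real, h3, h4]
    have h6 := neg_le_of_abs_le h5
    rw [hR']
    nlinarith
  have ht1 : |(51 / 100 : ℝ)| = 51 / 100 := by norm_num
  have ht2 : |(-51 / 100 : ℝ)| = 51 / 100 := by norm_num
  obtain ⟨K, L, hK, hL, hKL⟩ := exists_isInscribed_not_areSimilar h12 hℓ0 h0 hvR
    (by linarith) (by linarith) hvd (hxv _ ht1) (hxv _ ht2) (hxg _ ht1).le (hxg _ ht2).le (by
      have : centre T + (51 / 100 : ℝ) • (w 1 - w 2) - (centre T + (-51 / 100 : ℝ) • (w 1 - w 2)) =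
          (102 / 100 : ℝ) • (w 1 - w 2) := by module
      rw [this, norm_smul, hedge, Real.norm_of_nonneg (by norm_num)]
      linarith)
  have hR'0 : 0 < R' := by positivity
  have hR'ℓ : R' < ℓ := by linarith
  have eK := hK.asymmetry_eq h0 hvR hR'0 hR'ℓ
  have eL := hL.asymmetry_eq h0 hvR hR'0 hR'ℓ
  refine ⟨K, L, hK.maximal.isConstantWidth hℓ0, hL.maximal.isConstantWidth hℓ0, ?_, ?_, ?_,
    hK.not_symm h0 hvR (by linarith) hR'ℓ, hL.not_symm h0 hvR (by linarith) hR'ℓ, hKL⟩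
  · rw [hK.asymmetry_add hL h0 hvR hR'0 hR'ℓ, eK]
  · rw [eK, eL]
  · intro M hM
    rw [eK, ((isInscribed_iff_isCompletion h12 hℓ hℓ0).2 hM).asymmetry_eq
      (sum_points_sub_centre T) hnorm hR0 hRℓ]
    exact div_lt_div₀ hR'ρ (by linarith) hR0.le (by linarith)

/-- Since `y` is within `ℓ` of vertex `j`, it makes a nonnegative inner product with the edge from
vertex `i` to `j`; nonnegative combinations of these edges inherit this. -/
lemma inner_sub_point_nonneg (hℓ : ∀ i j, i ≠ j → dist (T.points i) (T.points j) = ℓ)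
    {y : E n} (hy : ∀ i, ‖y - T.points i‖ ≤ ℓ) {α : Fin (n + 1) → ℝ} (hα : ∑ i, α i = 0)
    {i : Fin (n + 1)} (hi : ∀ j, j ≠ i → 0 ≤ α j) :
    0 ≤ inner ℝ (y - T.points i) (∑ j, α j • T.points j) := by
  have h1 : ∑ j, α j • T.points j = ∑ j, α j • (T.points j - T.points i) := by
    simp only [smul_sub, Finset.sum_sub_distrib, ← Finset.sum_smul, hα, zero_smul, sub_zero]
  rw [h1, inner_sum]
  refine Finset.sum_nonneg fun j _ => ?_
  by_cases h : j = i
  · simp [h]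
  · rw [real_inner_smul_right]
    refine mul_nonneg (hi j h) ?_
    have h2 : ‖y - T.points j‖ ^ 2 ≤ ℓ ^ 2 := pow_le_pow_left₀ (norm_nonneg _) (hy j) 2
    rw [← sub_sub_sub_cancel_right y (T.points j) (T.points i), norm_sub_sq_real,
      ← dist_eq_norm (T.points j), hℓ j i h] at h2
    nlinarith [sq_nonneg ‖y - T.points i‖]

/-- The Reuleaux triangle has the same diameter as the regular triangle. -/
lemma diamLE_reuleaux {T : Affine.Simplex ℝ (E 2) 2}
    (hℓ : ∀ i j, i ≠ j → dist (T.points i) (T.points j) = ℓ) (hℓ0 : 0 ≤ ℓ) :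
    DiamLE (euclid 2) (⋂ i, (euclid 2).closedBall (T.points i) ℓ) ℓ := by
  have key : ∀ x y : E 2, (∀ i, ‖x - T.points i‖ ≤ ℓ) → (∀ i, ‖y - T.points i‖ ≤ ℓ) →
      ∀ α : Fin 3 → ℝ, ∑ i, α i = 0 → x - y = ∑ i, α i • T.points i →
      ∀ i, (∀ j, j ≠ i → 0 ≤ α j) → ‖x - y‖ ≤ ℓ := by
    intro x y hx hy α hα hxy i hi
    have h1 := inner_sub_point_nonneg hℓ hy hα hi
    rw [← hxy] at h1
    have h2 : ‖x - y‖ ^ 2 ≤ ℓ * ‖x - y‖ := by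
      have h3 : x - y = (x - T.points i) - (y - T.points i) := by abel
      have h4 := real_inner_le_norm (x - T.points i) (x - y)
      have h5 : ‖x - T.points i‖ * ‖x - y‖ ≤ ℓ * ‖x - y‖ := by gcongr; exact hx i
      have h6 : ‖x - y‖ ^ 2 =
          inner ℝ (x - T.points i) (x - y) - inner ℝ (y - T.points i) (x - y) := by
        rw [← inner_sub_left, ← h3, real_inner_self_eq_norm_sq]
      linarith
    by_contra hlt
    rw [not_le] at hlt
    nlinarith
  intro x hx y hy
  simp only [Set.mem_iInter, mem_closedBall_euclid] at hx hy
  obtain ⟨a, ha, hax⟩ := exists_coord T x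
  obtain ⟨b, hb, hby⟩ := exists_coord T y
  have h1 : ∀ (a b : Fin 3 → ℝ) (x y : E 2), x - centre T = ∑ i, a i • T.points i →
      y - centre T = ∑ i, b i • T.points i → x - y = ∑ i, (a i - b i) • T.points i := by
    intro a b x y hax hby
    simp only [sub_smul, Finset.sum_sub_distrib]
    rw [← hax, ← hby, sub_sub_sub_cancel_right]
  -- Among three signs at most one is negative or at most one is positive; with more vertices two of
  -- each could occur, so the argument is planar.
  have h2 : (∃ i, ∀ j, j ≠ i → 0 ≤ a j - b j) ∨ ∃ i, ∀ j, j ≠ i → 0 ≤ b j - a j := by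
    simp only [Fin.exists_fin_succ, Fin.forall_fin_succ]
    rcases le_total (a 0) (b 0) with h0 | h0 <;> rcases le_total (a 1) (b 1) with h1 | h1 <;>
      rcases le_total (a 2) (b 2) with h2 | h2 <;> simp [*]
  change ‖x - y‖ ≤ ℓ
  rcases h2 with ⟨i, hi⟩ | ⟨i, hi⟩
  · exact key x y hx hy _ (by rw [Finset.sum_sub_distrib, ha, hb, sub_self]) (h1 a b x y hax hby)
      i hi
  · rw [norm_sub_rev]
    exact key y x hy hx _ (by rw [Finset.sum_sub_distrib, ha, hb, sub_self]) (h1 b a y x hby hax)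
      i hi

/-- In the plane the Reuleaux triangle is the only completion of a regular triangle. -/
lemma isCompletion_iff_eq_reuleaux {T : Affine.Simplex ℝ (E 2) 2} {K : Set (E 2)}
    (hℓ : ∀ i j, i ≠ j → dist (T.points i) (T.points j) = ℓ) (hℓ0 : 0 < ℓ) :
    IsCompletion (euclid 2) (body T) K ↔ K = ⋂ i, (euclid 2).closedBall (T.points i) ℓ := by
  have hD := diamLE_reuleaux hℓ hℓ0.le
  have hdb := diam_body (by norm_num) hℓ hℓ0
  have hsub : ∀ {X : Set (E 2)}, DiamLE (euclid 2) X ℓ → body T ⊆ X →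
      X ⊆ ⋂ i, (euclid 2).closedBall (T.points i) ℓ := fun hX hT x hx =>
    Set.mem_iInter.2 fun i => (Seminorm.mem_closedBall _).2 (hX x hx _ (hT (points_mem_body T i)))
  constructor
  · intro h
    have hmax := h.isDiamMaximal
    rw [hdb] at hmax
    exact hmax.eq_of_subset hD (hsub hmax.2.1 h.1)
  · rintro rfl
    have hTQ := hsub (hdb ▸ diamLE_diam (isConvexBody_body T).2.1) Set.Subset.rfl
    have hmax : IsDiamMaximal (euclid 2) ℓ (⋂ i, (euclid 2).closedBall (T.points i) ℓ) := by
      refine ⟨⟨convex_iInter fun i => Seminorm.convex_closedBall _ _ _, ?_,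
        (isConvexBody_body T).2.2.mono hTQ⟩, hD, fun x hx => Set.mem_iInter.2 fun i =>
        (Seminorm.mem_closedBall _).2 (hx _ (hTQ (points_mem_body T i)))⟩
      exact (isCompact_seminorm_closedBall euclid_definite (T.points 0) ℓ).of_isClosed_subset
        (isClosed_iInter fun i => (isCompact_seminorm_closedBall euclid_definite _ _).isClosed)
        (Set.iInter_subset _ (0 : Fin 3))
    exact IsDiamMaximal.isCompletion (hdb.symm ▸ hmax) hTQ (isConvexBody_body T).2.2

end PropB

/-! ### Assembly of the main theorem -/

namespace PropB
variable {n : ℕ}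

lemma edge_pos {T : Affine.Simplex ℝ (E n) n} {ℓ : ℝ}
    (hℓ : ∀ i j, i ≠ j → dist (T.points i) (T.points j) = ℓ) (hn : 1 ≤ n) : 0 < ℓ := by
  have h01 : (0 : Fin (n + 1)) ≠ Fin.last n := Fin.ne_of_val_ne (by simp; omega)
  rw [← hℓ _ _ h01]
  exact dist_pos.2 (T.independent.injective.ne h01)

end PropB

theorem mainTheorem4 (n : ℕ) (T : Affine.Simplex ℝ (PropB.E n) n) (hT : T.Regular) :
    -- an arbitrary norm `N` on `ℝⁿ`, and a circumcentre `c` of `T`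
    (∀ (N : Seminorm ℝ (PropB.E n)) (_ : ∀ x, N x = 0 → x = 0) (c : PropB.E n)
        (_ : PropB.IsCircumcenter N (PropB.body T) c),
      (∃ K, PropB.IsCompletion N (PropB.body T) K ∧
        K ⊆ N.closedBall c (PropB.circumradius N (PropB.body T))) ∧
      (¬ PropB.IsCompleteBody N (PropB.pseudoCompletion N (PropB.body T) c) →
        ∀ P K : Set (PropB.E n), P = PropB.pseudoCompletion N (PropB.body T) c →
          PropB.IsCompletion N (PropB.body T) K →
          K ⊆ N.closedBall c (PropB.circumradius N (PropB.body T)) →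
          PropB.IsConvexBody P ∧ PropB.IsConvexBody K ∧
          PropB.circumradius N (P + K) + PropB.inradius N (P + K) =
            PropB.circumradius N P + PropB.inradius N P +
              (PropB.circumradius N K + PropB.inradius N K) ∧
          PropB.circumradius N P + PropB.inradius N P +
              (PropB.circumradius N K + PropB.inradius N K) = PropB.diam N P + PropB.diam N K ∧
          PropB.diam N P + PropB.diam N K = PropB.diam N (P + K) ∧
          PropB.asymmetry (P + K) = PropB.circumradius N (P + K) / PropB.inradius N (P + K) ∧
          PropB.asymmetry (P + K) = PropB.asymmetry P ∧
          PropB.asymmetry P = PropB.asymmetry K ∧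
          ¬ PropB.IsCentrallySymmetric P ∧ ¬ PropB.IsCentrallySymmetric K ∧
          ¬ PropB.AreSimilar N P K ∧ ¬ PropB.AreSimilar (PropB.euclid n) P K)) ∧
    -- Euclidean space satisfies the assumption, and there every completion of `T` is admissible
    (2 ≤ n → ∀ c, PropB.IsCircumcenter (PropB.euclid n) (PropB.body T) c →
      ¬ PropB.IsCompleteBody (PropB.euclid n)
          (PropB.pseudoCompletion (PropB.euclid n) (PropB.body T) c) ∧
      ∀ K, PropB.IsCompletion (PropB.euclid n) (PropB.body T) K →
        K ⊆ (PropB.euclid n).closedBall c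
          (PropB.circumradius (PropB.euclid n) (PropB.body T))) ∧
    -- property (B) fails for the Minkowski asymmetry, also for bodies of constant width
    (2 ≤ n → ¬ PropB.PropertyB (PropB.asymmetry (n := n)) {K | PropB.IsConvexBody K}) ∧
    (2 ≤ n → ¬ PropB.PropertyB (PropB.asymmetry (n := n))
      {K | PropB.IsConstantWidth (PropB.euclid n) K}) ∧
    -- two completions of `T` in Euclidean space
    (2 ≤ n → ∀ K L, PropB.IsCompletion (PropB.euclid n) (PropB.body T) K →
      PropB.IsCompletion (PropB.euclid n) (PropB.body T) L →
      PropB.IsConstantWidth (PropB.euclid n) K ∧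
      PropB.asymmetry (K + L) = PropB.asymmetry K ∧ PropB.asymmetry K = PropB.asymmetry L ∧
      ¬ PropB.IsCentrallySymmetric K) ∧
    (3 ≤ n → ∃ K L, PropB.IsCompletion (PropB.euclid n) (PropB.body T) K ∧
      PropB.IsCompletion (PropB.euclid n) (PropB.body T) L ∧
      ¬ PropB.AreSimilar (PropB.euclid n) K L) ∧
    -- the plane: the Reuleaux triangle is the only completion, but other bodies can be used
    (n = 2 →
      (∀ K, PropB.IsCompletion (PropB.euclid n) (PropB.body T) K ↔
        K = ⋂ i, (PropB.euclid n).closedBall (T.points i)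
          (PropB.diam (PropB.euclid n) (PropB.body T))) ∧
      ∃ K L, PropB.IsConstantWidth (PropB.euclid n) K ∧ PropB.IsConstantWidth (PropB.euclid n) L ∧
        PropB.asymmetry (K + L) = PropB.asymmetry K ∧ PropB.asymmetry K = PropB.asymmetry L ∧
        (∀ M, PropB.IsCompletion (PropB.euclid n) (PropB.body T) M →
          PropB.asymmetry K < PropB.asymmetry M) ∧
        ¬ PropB.IsCentrallySymmetric K ∧ ¬ PropB.IsCentrallySymmetric L ∧
        ¬ PropB.AreSimilar (PropB.euclid n) K L) := by
  obtain ⟨ℓ, hℓ⟩ := hT.equilateral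
  have hℓ0 : 1 ≤ n → 0 < ℓ := PropB.edge_pos hℓ
  have hcirc : 2 ≤ n → ∀ c, PropB.IsCircumcenter (PropB.euclid n) (PropB.body T) c →
      ¬ PropB.IsCompleteBody (PropB.euclid n)
          (PropB.pseudoCompletion (PropB.euclid n) (PropB.body T) c) ∧
      ∀ K, PropB.IsCompletion (PropB.euclid n) (PropB.body T) K →
        K ⊆ (PropB.euclid n).closedBall c (PropB.circumradius (PropB.euclid n) (PropB.body T)) := by
    intro hn c hc
    have h1 : 1 ≤ n := by omega
    refine ⟨PropB.not_isCompleteBody_pseudoCompletion hn hℓ (hℓ0 h1) hc, fun K hK => ?_⟩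
    rw [PropB.eq_centre_of_isCircumcenter h1 hℓ (hℓ0 h1) hc, PropB.circumradius_body h1 hℓ (hℓ0 h1)]
    exact PropB.completion_subset_circumball h1 hℓ (hℓ0 h1) hK
  have hcompl : 2 ≤ n → ∀ K L, PropB.IsCompletion (PropB.euclid n) (PropB.body T) K →
      PropB.IsCompletion (PropB.euclid n) (PropB.body T) L →
      PropB.IsConstantWidth (PropB.euclid n) K ∧
      PropB.asymmetry (K + L) = PropB.asymmetry K ∧ PropB.asymmetry K = PropB.asymmetry L ∧
      ¬ PropB.IsCentrallySymmetric K := by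
    intro hn K L hK hL
    have h1 : 1 ≤ n := by omega
    have h0 := PropB.sum_points_sub_centre T
    have hR := PropB.norm_points_sub_centre hℓ (hℓ0 h1).le
    have hR0 := PropB.regularRadius_pos h1 (hℓ0 h1)
    have hRℓ := PropB.regularRadius_lt h1 (hℓ0 h1)
    have iK := (PropB.isInscribed_iff_isCompletion h1 hℓ (hℓ0 h1)).2 hK
    have iL := (PropB.isInscribed_iff_isCompletion h1 hℓ (hℓ0 h1)).2 hL
    have eK := iK.asymmetry_eq h0 hR hR0 hRℓ
    refine ⟨iK.maximal.isConstantWidth (hℓ0 h1), ?_, ?_,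
      iK.not_symm h0 hR (PropB.lt_two_mul_regularRadius hn (hℓ0 h1)) hRℓ⟩
    · rw [iK.asymmetry_add iL h0 hR hR0 hRℓ, eK]
    · rw [eK, iL.asymmetry_eq h0 hR hR0 hRℓ]
  refine ⟨fun N hN c hc => ⟨PropB.exists_completion_subset (PropB.isConvexBody_body T) hc hN,
    fun hPc P K hP hK hKc => PropB.pseudoCompletion_completion hN hc hPc hP hK hKc⟩, hcirc,
    fun hn hB => ?_, fun hn hB => ?_, hcompl,
    fun hn => PropB.exists_completions_not_areSimilar hn hℓ (hℓ0 (by omega)), ?_⟩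
  · have h1 : 1 ≤ n := by omega
    have hc := PropB.isCircumcenter_centre h1 hℓ (hℓ0 h1)
    obtain ⟨K, hK, hKc⟩ := PropB.exists_completion_subset (PropB.isConvexBody_body T) hc
      PropB.euclid_definite
    obtain ⟨hPb, hKb, -, -, -, -, e1, e2, nP, nK, -, nsim⟩ := PropB.pseudoCompletion_completion
      PropB.euclid_definite hc (hcirc hn _ hc).1 rfl hK hKc
    rcases hB _ hPb _ hKb (by rw [e1, e2, max_self]) with h | h | h
    exacts [nP h, nK h, nsim h]
  -- In the plane the completion is unique, so the counterexample comes from the shrunken triangle;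
  -- in higher dimension two completions suffice.
  · rcases hn.eq_or_lt with rfl | hn3
    · obtain ⟨K, L, hK, hL, e1, e2, -, nK, nL, nsim⟩ :=
        PropB.exists_planar_not_areSimilar hℓ (hℓ0 (by norm_num))
      rcases hB _ hK _ hL (by rw [e1, ← e2, max_self]) with h | h | h
      exacts [nK h, nL h, nsim h]
    · obtain ⟨K, L, hK, hL, nsim⟩ :=
        PropB.exists_completions_not_areSimilar hn3 hℓ (hℓ0 (by omega))
      obtain ⟨cK, e1, e2, nK⟩ := hcompl hn K L hK hL
      obtain ⟨cL, -, -, nL⟩ := hcompl hn L K hL hK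
      rcases hB _ cK _ cL (by rw [e1, ← e2, max_self]) with h | h | h
      exacts [nK h, nL h, nsim h]
  · rintro rfl
    refine ⟨fun K => ?_, PropB.exists_planar_not_areSimilar hℓ (hℓ0 (by norm_num))⟩
    rw [PropB.diam_body (by norm_num) hℓ (hℓ0 (by norm_num))]
    exact PropB.isCompletion_iff_eq_reuleaux hℓ (hℓ0 (by norm_num))
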